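/- Let $\mathbb{K}$ be a commutative ring, $G$ a group, and $\mathcal{S}=(S_1,\dots,S_m)$ a finite family of subgroups of $G$ with $m\ge 1$ (that is, $\mathcal{S}\neq\emptyset$). For a $\mathbb{K}[G]$-module $A$, let $H_*(G,\mathcal{S};A)$ and $H^*(G,\mathcal{S};A)$ denote the relative group homology and cohomology of the pair $(G,\mathcal{S})$ in the sense of Bieri and Eckmann, i.e. the homology of the mapping cone of $\bigoplus_k C_*(S_k;A)\to C_*(G;A)$ and the cohomology of the homotopy fiber of $C^*(G;A)\to\prod_k C^*(S_k;A)$, where $C_*$ and $C^*$ are the bar complexes. Suppose that $(G,\mathcal{S})$ is a $\mathbb{K}$-Poincaré duality pair of dimension $n$ ($\mathbb{K}$-$\mathrm{PD}_n$ pair): there is a class $e\in H_n(G,\mathcal{S};\mathbb{K})$, with trivial coefficients $\mathbb{K}$, such that the cap products $$ e\cap\bullet:\ H^i(G,\mathcal{S};A)\to H_{n-i}(G;A),\qquad e\cap\bullet:\ H^i(G;A)\to H_{n-i}(G,\mathcal{S};A) $$ are isomorphisms for every $\mathbb{K}[G]$-module $A$ and every integer $i$ (groups in negative degrees being zero). Let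 $G_1,G_2$ be two copies of $G$. Let $H^{n-1}(G_1;\mathbb{K}[G])$ be the group cohomology with coefficients in $\mathbb{K}[G]$ regarded as a right $\mathbb{K}[G_1]$-module by right multiplication (equivalently, $g\in G_1$ acts by $x\mapsto xg^{-1}$), and regard it as a left $\mathbb{K}[G_2]$-module through left multiplication of $G_2=G$ on the coefficients $\mathbb{K}[G]$. Then there is an isomorphism of $\mathbb{K}$-modules $$ H^{n-1}\bigl(G_2,\mathcal{S};\,H^{n-1}(G_1;\mathbb{K}[G])\bigr)\;\cong\; H_2(G,\mathcal{S};\mathbb{K}). $$ -/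

import Mathlib

universe u

open CategoryTheory

noncomputable section

namespace FoxPairing

/-! ### The cap product on bar chains -/

/-- The first `i` entries of a tuple. -/
def front {H : Type u} {n i j : ℕ} (h : i + j = n) (g : Fin n → H) : Fin i → H :=
  fun a => g ⟨a, by omega⟩

/-- The last `j` entries of a tuple. -/
def back {H : Type u} {n i j : ℕ} (h : i + j = n) (g : Fin n → H) : Fin j → H :=
  fun b => g ⟨i + b, by omega⟩

lemma back_succ {H : Type u} {i j : ℕ} (g : Fin (i + j + 1) → H) :
    (fun b : Fin j => back (show i + (j + 1) = i + j + 1 by omega) g b.succ) =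
      back (show i + 1 + j = i + j + 1 by omega) g := by
  funext b
  simp only [back]
  congr 1
  ext
  simp
  omega

lemma back_tail {H : Type u} {i j : ℕ} (g : Fin (i + j + 1) → H) :
    back (rfl : i + j = i + j) (fun b : Fin (i + j) => g b.succ) =
      back (show i + 1 + j = i + j + 1 by omega) g := by
  funext b
  simp only [back]
  congr 1
  ext
  simp
  omega

section Cap

variable {K : Type u} {H : Type u} [CommRing K] [Group H] (A : Rep.{u} K H)

/-- The chain-level cap product `C_n(H; K) × Cⁱ(H; A) → C_j(H; A)`, `i + j = n`, on bar chains: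
`[g₁|…|g_n] ∩ f = (g₁⋯g_i)⁻¹ f(g₁, …, g_i) ⊗ [g_{i+1}|…|g_n]`. -/
def cap {n i j : ℕ} (h : i + j = n) :
    ((Fin n → H) →₀ K) →ₗ[K] ((Fin i → H) → A) →ₗ[K] ((Fin j → H) →₀ A) :=
  Finsupp.linearCombination K fun g =>
    Finsupp.lsingle (back h g) ∘ₗ A.ρ (Fin.partialProd g ⟨i, by omega⟩)⁻¹ ∘ₗ
      LinearMap.proj (front h g)

lemma cap_single {n i j : ℕ} (h : i + j = n) (g : Fin n → H) (r : K) (f : (Fin i → H) → A) :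
    cap A h (Finsupp.single g r) f =
      r • Finsupp.single (back h g) (A.ρ (Fin.partialProd g ⟨i, by omega⟩)⁻¹ (f (front h g))) := by
  simp [cap]

lemma front_contract_lt {i j : ℕ} (g : Fin (i + j + 1) → H) (a : Fin i) :
    front (rfl : i + j = i + j) (Fin.contractNth (n := i + j) (Fin.castAdd (j + 1) a) (· * ·) g) =
      Fin.contractNth a.castSucc (· * ·) (front (show i + 1 + j = i + j + 1 by omega) g) := by
  funext b
  simp only [front, Fin.contractNth]
  rfl

lemma back_contract_lt {i j : ℕ} (g : Fin (i + j + 1) → H) (a : Fin i) :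
    back (rfl : i + j = i + j) (Fin.contractNth (n := i + j) (Fin.castAdd (j + 1) a) (· * ·) g) =
      back (show i + 1 + j = i + j + 1 by omega) g := by
  funext b
  simp only [back]
  rw [Fin.contractNth_apply_of_gt _ _ _ _ (by change (a : ℕ) < i + b; omega)]
  congr 1
  ext
  simp
  omega

lemma partialProd_contract_lt {i j : ℕ} (g : Fin (i + j + 1) → H) (a : Fin i) :
    Fin.partialProd (Fin.contractNth (n := i + j) (Fin.castAdd (j + 1) a) (· * ·) g) ⟨i, by omega⟩ =
      Fin.partialProd g ⟨i + 1, by omega⟩ := by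
  have h := congrFun (Fin.partialProd_contractNth (n := i + j) g (Fin.castAdd (j + 1) a))
    ⟨i, by omega⟩
  refine h.trans (congrArg (Fin.partialProd g) ?_)
  ext
  simp [Fin.succAbove, Fin.lt_def, a.isLt.not_ge]

lemma front_contract_ge {i j : ℕ} (g : Fin (i + j + 1) → H) (a : Fin (j + 1)) :
    front (rfl : i + j = i + j) (Fin.contractNth (n := i + j) (Fin.natAdd i a) (· * ·) g) =
      front (show i + (j + 1) = i + j + 1 by omega) g := by
  funext b
  simp only [front]
  rw [Fin.contractNth_apply_of_lt _ _ _ _ (by simp; omega)]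
  rfl

lemma back_contract_ge {i j : ℕ} (g : Fin (i + j + 1) → H) (a : Fin (j + 1)) :
    back (rfl : i + j = i + j) (Fin.contractNth (n := i + j) (Fin.natAdd i a) (· * ·) g) =
      Fin.contractNth a (· * ·) (back (show i + (j + 1) = i + j + 1 by omega) g) := by
  funext b
  simp [back, Fin.contractNth, Nat.add_assoc]

lemma partialProd_contract_ge {i j : ℕ} (g : Fin (i + j + 1) → H) (a : Fin (j + 1)) :
    Fin.partialProd (Fin.contractNth (n := i + j) (Fin.natAdd i a) (· * ·) g) ⟨i, by omega⟩ =
      Fin.partialProd g ⟨i, by omega⟩ := by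
  have h := congrFun (Fin.partialProd_contractNth (n := i + j) g (Fin.natAdd i a))
    ⟨i, by omega⟩
  refine h.trans (congrArg (Fin.partialProd g) ?_)
  ext
  simp [Fin.succAbove, Fin.lt_def]

lemma contract_last {i j : ℕ} (g : Fin (i + j + 1) → H) :
    Fin.contractNth (Fin.last i) (· * ·) (front (show i + 1 + j = i + j + 1 by omega) g) =
      front (show i + (j + 1) = i + j + 1 by omega) g := by
  funext b
  rw [Fin.contractNth_apply_of_lt _ _ _ _ (by simp)]
  rfl

/-- The Leibniz rule `∂ (z ∩ f) = (-1)ⁱ (∂ z ∩ f - z ∩ δ f)`. -/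
lemma d_cap {n i j : ℕ} (h : i + (j + 1) = n + 1) (z : (Fin (n + 1) → H) →₀ K)
    (f : (Fin i → H) → A) :
    groupHomology.inhomogeneousChains.d A j (cap A h z f) =
      (-1 : K) ^ i • (cap A (show i + j = n by omega)
          (groupHomology.inhomogeneousChains.d (Rep.trivial K H K) n z) f
        - cap A (show (i + 1) + j = n + 1 by omega) z (inhomogeneousCochains.d A i f)) := by
  obtain rfl : i + j = n := by omega
  induction z using Finsupp.induction_linear with
  | zero => simp
  | add z w hz hw =>
    simp only [map_add, LinearMap.add_apply, hz, hw]
    module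
  | single g r =>
    rw [cap_single, cap_single, map_smul, groupHomology.inhomogeneousChains.d_single,
      groupHomology.inhomogeneousChains.d_single]
    simp only [map_add, map_sum, map_smul, LinearMap.add_apply, LinearMap.sum_apply, LinearMap.smul_apply, cap_single, inhomogeneousCochains.d_hom_apply]
    have hP : Fin.partialProd g ⟨i + 1, by omega⟩ =
        Fin.partialProd g ⟨i, by omega⟩ * back h g 0 :=
      Fin.partialProd_succ g ⟨i, by omega⟩
    have hP' : Fin.partialProd g ⟨i + 1, by omega⟩ =
        g 0 * Fin.partialProd (fun b : Fin (i + j) => g b.succ) ⟨i, by omega⟩ :=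
      Fin.partialProd_succ' g ⟨i, by omega⟩
    have e1 : A.ρ (back h g 0)⁻¹ (A.ρ (Fin.partialProd g ⟨i, by omega⟩)⁻¹ (f (front h g))) =
        A.ρ (Fin.partialProd g ⟨i + 1, by omega⟩)⁻¹ (f (front h g)) := by
      rw [hP, mul_inv_rev, map_mul]; rfl
    have e2 : A.ρ (Fin.partialProd g ⟨i + 1, by omega⟩)⁻¹
        (A.ρ (front (show i + 1 + j = i + j + 1 by omega) g 0)
          (f fun b => front (show i + 1 + j = i + j + 1 by omega) g b.succ)) =
        A.ρ (Fin.partialProd (fun b : Fin (i + j) => g b.succ) ⟨i, by omega⟩)⁻¹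
          (f (front (rfl : i + j = i + j) fun b => g b.succ)) := by
      rw [hP', mul_inv_rev, map_mul]
      change A.ρ _ (A.ρ (g 0)⁻¹ (A.ρ (g 0) _)) = _
      rw [← Module.End.mul_apply (A.ρ (g 0)⁻¹), ← map_mul, inv_mul_cancel, map_one]
      rfl
    have e3 := Fin.sum_univ_add (a := i) (b := j + 1) (fun x : Fin (i + (j + 1)) =>
      (-1 : K) ^ ((x : ℕ) + 1) • r • Finsupp.single
        (back (rfl : i + j = i + j) (Fin.contractNth (n := i + j) x (· * ·) g))
        (A.ρ (Fin.partialProd (Fin.contractNth (n := i + j) x (· * ·) g) ⟨i, by omega⟩)⁻¹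
          (f (front (rfl : i + j = i + j) (Fin.contractNth (n := i + j) x (· * ·) g)))))
    simp only [front_contract_lt, back_contract_lt, partialProd_contract_lt, front_contract_ge,
      back_contract_ge, partialProd_contract_ge] at e3
    refine Eq.trans ?_ (congrArg (fun t => (-1 : K) ^ i • (_ + t - _)) e3.symm)
    rw [Fin.sum_univ_castSucc (n := i), contract_last, e2, e1, back_succ, back_tail]
    simp only [Finsupp.single_add, Finsupp.single_finsetSum, ← Finsupp.smul_single,
      Representation.trivial_apply, smul_add, smul_sub, Finset.smul_sum, Fin.val_castAdd,
      Fin.val_natAdd, Fin.val_castSucc, Fin.val_last]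
    have s1 : (-1 : K) ^ i * (-1) ^ i = 1 := by rw [← pow_add, ← two_mul, pow_mul]; simp
    have e4 : ∀ (x : ℕ) (y : (Fin j → H) →₀ A),
        (-1 : K) ^ i • (-1 : K) ^ (i + x + 1) • r • y = r • (-1 : K) ^ (x + 1) • y := by
      intro x y
      rw [smul_smul, smul_smul, smul_smul]
      congr 1
      rw [add_assoc, pow_add, ← mul_assoc, s1]; ring
    have e5 : ∀ y : (Fin j → H) →₀ A,
        (-1 : K) ^ i • r • (-1 : K) ^ (i + 1) • y = - r • y := by
      intro y
      rw [smul_smul, smul_smul]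
      congr 1
      linear_combination (- r) * s1
    have e6 : ∀ (x : ℕ) (y : (Fin j → H) →₀ A),
        (-1 : K) ^ i • (-1 : K) ^ (x + 1) • r • y = (-1 : K) ^ i • r • (-1 : K) ^ (x + 1) • y := by
      intro x y
      rw [smul_comm r]
    simp only [e4, e5, e6]
    module

/-- The cap product is natural with respect to group homomorphisms. -/
lemma map_cap {L : Type u} [Group L] (φ : L →* H) {n i j : ℕ} (h : i + j = n)
    (w : (Fin n → L) →₀ K) (f : (Fin i → H) → A) :
    (groupHomology.chainsMap φ (𝟙 (Rep.res φ A))).f j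
        (cap (Rep.res φ A) h w ((groupCohomology.cochainsMap φ (𝟙 (Rep.res φ A))).f i f)) =
      cap A h ((groupHomology.chainsMap φ (𝟙 (Rep.res φ (Rep.trivial K H K)))).f n w) f := by
  induction w using Finsupp.induction_linear with
  | zero => simp
  | add z w hz hw => simp only [map_add, LinearMap.add_apply, hz, hw]
  | single g r =>
    have h2 : Fin.partialProd (φ ∘ g) ⟨i, by omega⟩ = φ (Fin.partialProd g ⟨i, by omega⟩) := by
      simp [Fin.partialProd, map_list_prod, List.map_take, List.map_ofFn]
    rw [cap_single, map_smul]
    erw [groupHomology.chainsMap_f_single, groupHomology.chainsMap_f_single]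
    erw [cap_single]
    rw [h2, ← map_inv]
    rfl

end Cap
/-! ### Mapping cones of families of (co)chain maps -/

section Cone

variable {K : Type u} [CommRing K] {m : ℕ}

/-- The modules of the mapping cone of a family `φ k : C k ⟶ D` of chain maps: in degree `n` they
are `D n ⊕ ⨁ k, (C k) (n - 1)`, where the second summand is absent for `n = 0`. -/
def coneX (C : Fin m → ChainComplex (ModuleCat.{u} K) ℕ) (D : ChainComplex (ModuleCat.{u} K) ℕ) :
    ℕ → ModuleCat.{u} K
  | 0 => D.X 0
  | n + 1 => ModuleCat.of K (D.X (n + 1) × ∀ k, (C k).X n)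

/-- The differential `(z, w) ↦ (∂ z + ∑ k, φ k (w k), - ∂ w)` of the mapping cone. -/
def coneD {C : Fin m → ChainComplex (ModuleCat.{u} K) ℕ} {D : ChainComplex (ModuleCat.{u} K) ℕ}
    (φ : ∀ k, C k ⟶ D) : ∀ n : ℕ, coneX C D (n + 1) ⟶ coneX C D n
  | 0 => ModuleCat.ofHom (X := D.X 1 × ∀ k, (C k).X 0) (Y := D.X 0)
      { toFun := fun x => D.d 1 0 x.1 + ∑ k, (φ k).f 0 (x.2 k)
        map_add' := fun x y => by
          simp only [Prod.fst_add, Prod.snd_add, Pi.add_apply, map_add, Finset.sum_add_distrib]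
          abel
        map_smul' := fun r x => by simp [Finset.smul_sum] }
  | n + 1 => ModuleCat.ofHom (X := D.X (n + 2) × ∀ k, (C k).X (n + 1))
      (Y := D.X (n + 1) × ∀ k, (C k).X n)
      { toFun := fun x => (D.d (n + 2) (n + 1) x.1 + ∑ k, (φ k).f (n + 1) (x.2 k),
          fun k => - (C k).d (n + 1) n (x.2 k))
        map_add' := fun x y => by
          refine Prod.ext ?_ (funext fun k => ?_)
          · simp only [Prod.fst_add, Prod.snd_add, Pi.add_apply, map_add, Finset.sum_add_distrib]
            abel
          · simp only [Prod.snd_add, Pi.add_apply, map_add, neg_add]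
        map_smul' := fun r x => by
          refine Prod.ext ?_ (funext fun k => ?_)
          · simp [Finset.smul_sum]
          · simp }

lemma coneD_zero_apply {C : Fin m → ChainComplex (ModuleCat.{u} K) ℕ}
    {D : ChainComplex (ModuleCat.{u} K) ℕ} (φ : ∀ k, C k ⟶ D) (x : D.X 1 × ∀ k, (C k).X 0) :
    coneD φ 0 x = D.d 1 0 x.1 + ∑ k, (φ k).f 0 (x.2 k) := rfl

lemma coneD_succ_apply {C : Fin m → ChainComplex (ModuleCat.{u} K) ℕ}
    {D : ChainComplex (ModuleCat.{u} K) ℕ} (φ : ∀ k, C k ⟶ D) (n : ℕ)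
    (x : D.X (n + 2) × ∀ k, (C k).X (n + 1)) :
    coneD φ (n + 1) x = ((D.d (n + 2) (n + 1) x.1 + ∑ k, (φ k).f (n + 1) (x.2 k),
      fun k => - (C k).d (n + 1) n (x.2 k)) : D.X (n + 1) × ∀ k, (C k).X n) := rfl

lemma comm_apply {ι : Type} {c : ComplexShape ι} {C D : HomologicalComplex (ModuleCat.{u} K) c}
    (φ : C ⟶ D) (i j : ι) (x : C.X i) :
    φ.f j (C.d i j x) = D.d i j (φ.f i x) := by
  rw [← ModuleCat.comp_apply, ← ModuleCat.comp_apply, φ.comm]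

lemma d_d_apply {ι : Type} {c : ComplexShape ι} (C : HomologicalComplex (ModuleCat.{u} K) c)
    (i j l : ι) (x : C.X i) : C.d j l (C.d i j x) = 0 := by
  rw [← ModuleCat.comp_apply, C.d_comp_d]; rfl

lemma coneD_comp {C : Fin m → ChainComplex (ModuleCat.{u} K) ℕ}
    {D : ChainComplex (ModuleCat.{u} K) ℕ} (φ : ∀ k, C k ⟶ D) (n : ℕ) :
    coneD φ (n + 1) ≫ coneD φ n = 0 := by
  ext x
  rw [ModuleCat.comp_apply]
  obtain ⟨z, w⟩ : D.X (n + 2) × ∀ k, (C k).X (n + 1) := x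
  rw [coneD_succ_apply]
  cases n with
  | zero =>
    rw [coneD_zero_apply]
    simp only [map_add, map_sum, map_neg, d_d_apply, comm_apply]
    simp
    rfl
  | succ n =>
    rw [coneD_succ_apply]
    simp only [map_add, map_sum, map_neg, d_d_apply, comm_apply]
    simp
    rfl

/-- The mapping cone of a family of chain maps. -/
def cone {C : Fin m → ChainComplex (ModuleCat.{u} K) ℕ} {D : ChainComplex (ModuleCat.{u} K) ℕ}
    (φ : ∀ k, C k ⟶ D) : ChainComplex (ModuleCat.{u} K) ℕ :=
  ChainComplex.of (coneX C D) (coneD φ) (coneD_comp φ)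

lemma cone_d {C : Fin m → ChainComplex (ModuleCat.{u} K) ℕ}
    {D : ChainComplex (ModuleCat.{u} K) ℕ} (φ : ∀ k, C k ⟶ D) (n : ℕ) :
    (cone φ).d (n + 1) n = coneD φ n :=
  by simp [cone]

/-- The modules of the (shifted) mapping cone of a family `ρ k : D ⟶ C k` of cochain maps: in
degree `n` they are `D n ⊕ ∏ k, (C k) (n - 1)`, where the second factor is absent for `n = 0`. -/
def fiberX (D : CochainComplex (ModuleCat.{u} K) ℕ)
    (C : Fin m → CochainComplex (ModuleCat.{u} K) ℕ) : ℕ → ModuleCat.{u} K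
  | 0 => D.X 0
  | n + 1 => ModuleCat.of K (D.X (n + 1) × ∀ k, (C k).X n)

/-- The differential `(f, h) ↦ (δ f, ρ k f - δ (h k))`. -/
def fiberD {D : CochainComplex (ModuleCat.{u} K) ℕ}
    {C : Fin m → CochainComplex (ModuleCat.{u} K) ℕ}
    (ρ : ∀ k, D ⟶ C k) : ∀ n : ℕ, fiberX D C n ⟶ fiberX D C (n + 1)
  | 0 => ModuleCat.ofHom (X := D.X 0) (Y := D.X 1 × ∀ k, (C k).X 0)
      { toFun := fun f => (D.d 0 1 f, fun k => (ρ k).f 0 f)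
        map_add' := fun x y => by
          refine Prod.ext ?_ (funext fun k => ?_)
          · simp only [Prod.fst_add, map_add]
          · simp only [Prod.snd_add, Pi.add_apply, map_add]
        map_smul' := fun r x => by
          refine Prod.ext ?_ (funext fun k => ?_)
          · simp
          · simp }
  | n + 1 => ModuleCat.ofHom (X := D.X (n + 1) × ∀ k, (C k).X n)
      (Y := D.X (n + 2) × ∀ k, (C k).X (n + 1))
      { toFun := fun x => (D.d (n + 1) (n + 2) x.1,
          fun k => (ρ k).f (n + 1) x.1 - (C k).d n (n + 1) (x.2 k))
        map_add' := fun x y => by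
          refine Prod.ext ?_ (funext fun k => ?_)
          · simp only [Prod.fst_add, map_add]
          · simp only [Prod.fst_add, Prod.snd_add, Pi.add_apply, map_add]
            abel
        map_smul' := fun r x => by
          refine Prod.ext ?_ (funext fun k => ?_)
          · simp
          · simp [smul_sub] }

lemma fiberD_zero_apply {D : CochainComplex (ModuleCat.{u} K) ℕ}
    {C : Fin m → CochainComplex (ModuleCat.{u} K) ℕ} (ρ : ∀ k, D ⟶ C k) (f : D.X 0) :
    fiberD ρ 0 f = ((D.d 0 1 f, fun k => (ρ k).f 0 f) : D.X 1 × ∀ k, (C k).X 0) := rfl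

lemma fiberD_succ_apply {D : CochainComplex (ModuleCat.{u} K) ℕ}
    {C : Fin m → CochainComplex (ModuleCat.{u} K) ℕ} (ρ : ∀ k, D ⟶ C k) (n : ℕ)
    (x : D.X (n + 1) × ∀ k, (C k).X n) :
    fiberD ρ (n + 1) x = ((D.d (n + 1) (n + 2) x.1,
      fun k => (ρ k).f (n + 1) x.1 - (C k).d n (n + 1) (x.2 k)) :
        D.X (n + 2) × ∀ k, (C k).X (n + 1)) := rfl

lemma fiberD_comp {D : CochainComplex (ModuleCat.{u} K) ℕ}
    {C : Fin m → CochainComplex (ModuleCat.{u} K) ℕ} (ρ : ∀ k, D ⟶ C k) (n : ℕ) :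
    fiberD ρ n ≫ fiberD ρ (n + 1) = 0 := by
  ext x
  rw [ModuleCat.comp_apply]
  cases n with
  | zero =>
    erw [fiberD_zero_apply, fiberD_succ_apply]
    refine Prod.ext (d_d_apply D 0 1 2 x) (funext fun k => ?_)
    exact sub_eq_zero.2 (comm_apply (ρ k) 0 1 x)
  | succ n =>
    obtain ⟨f, h⟩ : D.X (n + 1) × ∀ k, (C k).X n := x
    rw [fiberD_succ_apply, fiberD_succ_apply]
    refine Prod.ext (d_d_apply D _ _ _ f) (funext fun k => ?_)
    simp only [map_sub, d_d_apply, comm_apply]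
    simp
    rfl

/-- The (shifted) mapping cone, i.e. homotopy fiber, of a family of cochain maps. -/
def fiber {D : CochainComplex (ModuleCat.{u} K) ℕ}
    {C : Fin m → CochainComplex (ModuleCat.{u} K) ℕ} (ρ : ∀ k, D ⟶ C k) :
    CochainComplex (ModuleCat.{u} K) ℕ :=
  CochainComplex.of (fiberX D C) (fiberD ρ) (fiberD_comp ρ)

lemma fiber_d {D : CochainComplex (ModuleCat.{u} K) ℕ}
    {C : Fin m → CochainComplex (ModuleCat.{u} K) ℕ} (ρ : ∀ k, D ⟶ C k) (n : ℕ) :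
    (fiber ρ).d n (n + 1) = fiberD ρ n := by
  simp [fiber]

lemma mapHomology_aux₁ (C : CochainComplex (ModuleCat.{u} K) ℕ)
    (D : ChainComplex (ModuleCat.{u} K) ℕ) {i j : ℕ} (t : C.X i ⟶ D.X j)
    (h₁ : ∀ j', j' + 1 = j → ∃ t' : C.X (i + 1) ⟶ D.X j', t ≫ D.d j j' = C.d i (i + 1) ≫ t') :
    (C.iCycles i ≫ t) ≫ D.d j ((ComplexShape.down ℕ).next j) = 0 := by
  cases j with
  | zero => rw [D.shape _ _ (by simp), Limits.comp_zero]
  | succ j =>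
    obtain ⟨t', ht'⟩ := h₁ j rfl
    rw [ChainComplex.next_nat_succ, Category.assoc, ht', C.iCycles_d_assoc, Limits.zero_comp]

lemma mapHomology_aux₂ (C : CochainComplex (ModuleCat.{u} K) ℕ)
    (D : ChainComplex (ModuleCat.{u} K) ℕ) {i j : ℕ} (t : C.X i ⟶ D.X j)
    (h₁ : ∀ j', j' + 1 = j → ∃ t' : C.X (i + 1) ⟶ D.X j', t ≫ D.d j j' = C.d i (i + 1) ≫ t')
    (h₂ : ∀ i', i' + 1 = i → ∃ s : C.X i' ⟶ D.X (j + 1), C.d i' i ≫ t = s ≫ D.d (j + 1) j) :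
    (C.sc i).toCycles ≫ D.liftCycles (C.iCycles i ≫ t) _ rfl (mapHomology_aux₁ C D t h₁) ≫
      D.homologyπ j = 0 := by
  cases i with
  | zero =>
    have h0 : (C.sc 0).toCycles = 0 := by
      rw [← cancel_mono (C.sc 0).iCycles, ShortComplex.toCycles_i, Limits.zero_comp]
      exact C.shape _ _ (by simp)
    rw [h0, Limits.zero_comp]
  | succ i =>
    obtain ⟨s, hs⟩ := h₂ i rfl
    have key : C.toCycles i (i + 1) ≫ D.liftCycles (C.iCycles (i + 1) ≫ t) _ rfl
        (mapHomology_aux₁ C D t h₁) = s ≫ D.toCycles (j + 1) j := by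
      rw [← cancel_mono (D.iCycles j)]
      simp [hs]
    have h0 : D.toCycles (j + 1) j ≫ D.homologyπ j = 0 := D.toCycles_comp_homologyπ _ _
    have h2 : (C.sc (i + 1)).toCycles =
        C.toCycles ((ComplexShape.up ℕ).prev (i + 1)) (i + 1) :=
      (cancel_mono (C.sc (i + 1)).iCycles).1
        ((C.sc (i + 1)).toCycles_i.trans (C.toCycles_i _ _).symm)
    have h3 : ∀ p, p = i → C.toCycles p (i + 1) ≫ D.liftCycles (C.iCycles (i + 1) ≫ t) _ rfl
        (mapHomology_aux₁ C D t h₁) ≫ D.homologyπ j = 0 := by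
      rintro p rfl
      rw [reassoc_of% key, h0, Limits.comp_zero]
    exact (congrArg (· ≫ _) h2).trans (h3 _ (CochainComplex.prev_nat_succ i))

/-- A linear map between the terms of degree `i` of a cochain complex and of degree `j` of a chain
complex which is compatible with the differentials on both sides induces a map on (co)homology. -/
def mapHomology (C : CochainComplex (ModuleCat.{u} K) ℕ) (D : ChainComplex (ModuleCat.{u} K) ℕ)
    {i j : ℕ} (t : C.X i ⟶ D.X j)
    (h₁ : ∀ j', j' + 1 = j → ∃ t' : C.X (i + 1) ⟶ D.X j', t ≫ D.d j j' = C.d i (i + 1) ≫ t')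
    (h₂ : ∀ i', i' + 1 = i → ∃ s : C.X i' ⟶ D.X (j + 1), C.d i' i ≫ t = s ≫ D.d (j + 1) j) :
    C.homology i ⟶ D.homology j :=
  (C.sc i).descHomology
    (D.liftCycles (C.iCycles i ≫ t) _ rfl (mapHomology_aux₁ C D t h₁) ≫ D.homologyπ j)
    (mapHomology_aux₂ C D t h₁ h₂)

end Cone
/-! ### Relative group (co)homology and Poincaré duality pairs -/

section Relative

variable {K G : Type u} [CommRing K] [Group G] {m : ℕ}

/-- The chain map `C_*(S k; A) ⟶ C_*(G; A)` of bar complexes induced by the inclusion. -/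
abbrev inclMap (S : Fin m → Subgroup G) (A : Rep.{u} K G) (k : Fin m) :
    groupHomology.inhomogeneousChains (Rep.res (S k).subtype A) ⟶
      groupHomology.inhomogeneousChains A :=
  groupHomology.chainsMap (S k).subtype (𝟙 (Rep.res (S k).subtype A))

/-- The restriction cochain map `C^*(G; A) ⟶ C^*(S k; A)`. -/
abbrev resMap (S : Fin m → Subgroup G) (A : Rep.{u} K G) (k : Fin m) :
    groupCohomology.inhomogeneousCochains A ⟶
      groupCohomology.inhomogeneousCochains (Rep.res (S k).subtype A) :=
  groupCohomology.cochainsMap (S k).subtype (𝟙 (Rep.res (S k).subtype A))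

/-- The relative chain complex `C_*(G, 𝒮; A)` of a group `G` and a finite family
`𝒮 = (S 0, …, S (m - 1))` of subgroups: the mapping cone of the map
`⨁ k, C_*(S k; A) ⟶ C_*(G; A)` of inhomogeneous (bar) chain complexes induced by the inclusions.
For one subgroup this map is injective and the cone is quasi-isomorphic to the quotient complex
`C_*(G; A) / C_*(S; A)`. For several subgroups the cone keeps the subcomplexes `C_*(S k; A)`
disjoint (inside `C_*(G; A)` they overlap in the chains of the trivial subgroup), so that
`H_*(𝒮; A) = ⨁ k, H_*(S k; A)` in the long exact sequence of the pair, as for Bieri and Eckmann. -/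
def relChains (S : Fin m → Subgroup G) (A : Rep.{u} K G) : ChainComplex (ModuleCat.{u} K) ℕ :=
  cone (inclMap S A)

/-- The relative cochain complex `C^*(G, 𝒮; A)`: the homotopy fiber of the restriction map
`C^*(G; A) ⟶ ∏ k, C^*(S k; A)` of inhomogeneous cochain complexes. For one subgroup it is
quasi-isomorphic to the complex of cochains of `G` that vanish on tuples of elements of `S`. -/
def relCochains (S : Fin m → Subgroup G) (A : Rep.{u} K G) : CochainComplex (ModuleCat.{u} K) ℕ :=
  fiber (resMap S A)

/-- The relative group homology `H_n(G, 𝒮; A)`. -/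
def relHomology (S : Fin m → Subgroup G) (A : Rep.{u} K G) (n : ℕ) : ModuleCat.{u} K :=
  (relChains S A).homology n

/-- The relative group cohomology `Hⁿ(G, 𝒮; A)`. -/
def relCohomology (S : Fin m → Subgroup G) (A : Rep.{u} K G) (n : ℕ) : ModuleCat.{u} K :=
  (relCochains S A).homology n

variable (S : Fin m → Subgroup G) (A : Rep.{u} K G)

/-- A relative chain with trivial coefficients is a pair `(z, w)` with `z` a chain of `G`
of degree `n`; this is `z`. -/
def chainPart : ∀ {n : ℕ}, (relChains S (Rep.trivial K G K)).X n → ((Fin n → G) →₀ K)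
  | 0, e => e
  | _ + 1, e => e.1

/-- A relative chain with trivial coefficients of degree `n + 1` is a pair `(z, w)` with `w` a
family of chains of the subgroups of degree `n`; this is `w`. -/
def bdryPart {n : ℕ} (e : (relChains S (Rep.trivial K G K)).X (n + 1)) (k : Fin m) :
    (Fin n → S k) →₀ K :=
  (e : _ × _).2 k

/-- Chain-level cap product `Cⁱ(G; A) → C_j(G, 𝒮; A)`, `i + j = n`, with a relative chain
`e = (z, w)` of degree `n` with trivial coefficients: `f ↦ (z ∩ f, (-1)ⁱ w k ∩ f|_{S k})`. -/
def capAbs : ∀ {n i j : ℕ} (_ : i + j = n) (_ : (relChains S (Rep.trivial K G K)).X n),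
    (groupCohomology.inhomogeneousCochains A).X i ⟶ (relChains S A).X j
  | _, _, 0, h, e => ModuleCat.ofHom (cap A h (chainPart S e))
  | 0, _, _ + 1, h, _ => (show False by omega).elim
  | _ + 1, i, _ + 1, h, e => ModuleCat.ofHom <|
      (cap A h (chainPart S e)).prod <| LinearMap.pi fun k =>
        (-1 : K) ^ i • cap (Rep.res (S k).subtype A) (Nat.succ.inj h) (bdryPart S e k) ∘ₗ
          ((resMap S A k).f i).hom

/-- Chain-level cap product `Cⁱ(G, 𝒮; A) → C_j(G; A)`, `i + j = n`, with a relative chain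
`e = (z, w)` of degree `n` with trivial coefficients: `(f, h) ↦ z ∩ f + ∑ k, w k ∩ h k`. -/
def capRel : ∀ {n i j : ℕ} (_ : i + j = n) (_ : (relChains S (Rep.trivial K G K)).X n),
    (relCochains S A).X i ⟶ (groupHomology.inhomogeneousChains A).X j
  | _, 0, _, h, e => ModuleCat.ofHom (cap A h (chainPart S e))
  | 0, _ + 1, _, h, _ => (show False by omega).elim
  | n + 1, i + 1, j, h, e => ModuleCat.ofHom <|
      (cap A h (chainPart S e)).coprod <| ∑ k,
        ((inclMap S A k).f j).hom ∘ₗ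
          cap (Rep.res (S k).subtype A) (show i + j = n by omega) (bdryPart S e k) ∘ₗ
            LinearMap.proj k

lemma relCycle_zero {n : ℕ} (e : (relChains S (Rep.trivial K G K)).X (n + 1))
    (he : (relChains S (Rep.trivial K G K)).d (n + 1) n e = 0) :
    groupHomology.inhomogeneousChains.d (Rep.trivial K G K) n (chainPart S e) =
      - ∑ k, (inclMap S (Rep.trivial K G K) k).f n (bdryPart S e k) := by
  rw [eq_neg_iff_add_eq_zero, ← groupHomology.inhomogeneousChains.d_def]
  replace he : coneD (inclMap S (Rep.trivial K G K)) n e = 0 := by rw [← cone_d]; exact he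
  cases n with
  | zero => exact he
  | succ n => exact congrArg Prod.fst he

lemma relCycle_succ {n : ℕ} (e : (relChains S (Rep.trivial K G K)).X (n + 2))
    (he : (relChains S (Rep.trivial K G K)).d (n + 2) (n + 1) e = 0) (k : Fin m) :
    groupHomology.inhomogeneousChains.d (Rep.trivial K (S k) K) n (bdryPart S e k) = 0 := by
  replace he : coneD (inclMap S (Rep.trivial K G K)) (n + 1) e = 0 := by rw [← cone_d]; exact he
  have h := congrFun (congrArg Prod.snd he) k
  rw [← groupHomology.inhomogeneousChains.d_def]
  exact neg_eq_zero.1 h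

lemma d_capAbs_fst {n i j : ℕ} (h : i + (j + 1) = n + 1)
    (e : (relChains S (Rep.trivial K G K)).X (n + 1))
    (he : (relChains S (Rep.trivial K G K)).d (n + 1) n e = 0)
    (f : (groupCohomology.inhomogeneousCochains A).X i) :
    (groupHomology.inhomogeneousChains A).d (j + 1) j (cap A h (chainPart S e) f) +
      ∑ k, (inclMap S A k).f j
        ((-1 : K) ^ i • cap (Rep.res (S k).subtype A) (show i + j = n by omega) (bdryPart S e k)
          ((resMap S A k).f i f)) =
      (-1 : K) ^ (i + 1) • cap A (show i + 1 + j = n + 1 by omega) (chainPart S e)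
        ((groupCohomology.inhomogeneousCochains A).d i (i + 1) f) := by
  have hz := relCycle_zero S e he
  rw [groupHomology.inhomogeneousChains.d_def, groupCohomology.inhomogeneousCochains.d_def]
  simp only [map_smul]
  rw [← Finset.smul_sum]
  have h1 : ∀ k, (inclMap S A k).f j
        (cap (Rep.res (S k).subtype A) (show i + j = n by omega) (bdryPart S e k)
          ((resMap S A k).f i f)) =
      cap A (show i + j = n by omega) ((inclMap S (Rep.trivial K G K) k).f n (bdryPart S e k)) f :=
    fun k => map_cap A (S k).subtype _ _ f
  have h2 := d_cap A h (chainPart S e) f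
  rw [hz] at h2
  refine (congrArg₂ (· + (-1 : K) ^ i • ·) h2 (Finset.sum_congr rfl fun k _ => h1 k)).trans ?_
  simp only [map_neg, map_sum, LinearMap.neg_apply, LinearMap.sum_apply]
  rw [pow_succ]
  module

lemma d_capAbs_apply {n i j : ℕ} (h : i + (j + 1) = n + 1) (h' : i + 1 + j = n + 1)
    (e : (relChains S (Rep.trivial K G K)).X (n + 1))
    (he : ∀ p, (relChains S (Rep.trivial K G K)).d (n + 1) p e = 0)
    (f : (groupCohomology.inhomogeneousCochains A).X i) :
    (relChains S A).d (j + 1) j (capAbs S A h e f) = (-1 : K) ^ (i + 1) • capAbs S A h' e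
      ((groupCohomology.inhomogeneousCochains A).d i (i + 1) f) := by
  have key := d_capAbs_fst S A h e (he n) f
  refine Eq.trans (b := coneD (inclMap S A) j (capAbs S A h e f)) (by rw [← cone_d]; rfl) ?_
  cases j with
  | zero => exact key
  | succ j =>
    obtain ⟨n, rfl⟩ : ∃ n', n = n' + 1 := ⟨i + j, by omega⟩
    refine Prod.ext key (funext fun k => ?_)
    have hw := relCycle_succ S e (he _) k
    have h2 := d_cap (Rep.res (S k).subtype A) (show i + (j + 1) = n + 1 by omega)
      (bdryPart S e k)
      ((resMap S A k).f i f)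
    rw [hw] at h2
    have h3 := groupCohomology.inhomogeneousCochains.d_def (Rep.res (S k).subtype A) i
    have h4 := comm_apply (resMap S A k) i (i + 1) f
    change - (groupHomology.inhomogeneousChains (Rep.res (S k).subtype A)).d (j + 1) j
        ((-1 : K) ^ i • cap (Rep.res (S k).subtype A) (show i + (j + 1) = n + 1 by omega)
          (bdryPart S e k) ((resMap S A k).f i f)) =
      (-1 : K) ^ (i + 1) • (-1 : K) ^ (i + 1) • cap (Rep.res (S k).subtype A)
        (show i + 1 + j = n + 1 by omega) (bdryPart S e k)
          ((resMap S A k).f (i + 1)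
            ((groupCohomology.inhomogeneousCochains A).d i (i + 1) f))
    rw [h4, h3, map_smul, groupHomology.inhomogeneousChains.d_def]
    refine (congrArg (fun t => - ((-1 : K) ^ i • t)) h2).trans ?_
    simp only [map_zero, LinearMap.zero_apply, zero_sub, pow_succ]
    module

lemma d_capAbs {n i j : ℕ} (h : i + (j + 1) = n) (h' : i + 1 + j = n)
    (e : (relChains S (Rep.trivial K G K)).X n)
    (he : ∀ p, (relChains S (Rep.trivial K G K)).d n p e = 0) :
    capAbs S A h e ≫ (relChains S A).d (j + 1) j =
      (groupCohomology.inhomogeneousCochains A).d i (i + 1) ≫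
        ((-1 : K) ^ (i + 1) • capAbs S A h' e) := by
  obtain ⟨n, rfl⟩ : ∃ n', n = n' + 1 := ⟨i + j, by omega⟩
  ext f
  exact d_capAbs_apply S A h h' e he f

lemma capRel_succ_apply {n i j : ℕ} (h : i + 1 + j = n + 1)
    (e : (relChains S (Rep.trivial K G K)).X (n + 1))
    (f : (groupCohomology.inhomogeneousCochains A).X (i + 1))
    (y : ∀ k, (groupCohomology.inhomogeneousCochains (Rep.res (S k).subtype A)).X i) :
    capRel S A h e ((f, y) : (groupCohomology.inhomogeneousCochains A).X (i + 1) ×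
      ∀ k, (groupCohomology.inhomogeneousCochains (Rep.res (S k).subtype A)).X i) =
    cap A h (chainPart S e) f + ∑ k, (inclMap S A k).f j (cap (Rep.res (S k).subtype A)
        (show i + j = n by omega) (bdryPart S e k) (y k)) := by
  change cap A h (chainPart S e) f + (∑ k, ((inclMap S A k).f j).hom ∘ₗ
    cap (Rep.res (S k).subtype A) (show i + j = n by omega) (bdryPart S e k) ∘ₗ
      LinearMap.proj k) y = _
  rw [LinearMap.sum_apply]
  rfl

lemma d_cap_cycle {n i j : ℕ} (h : i + (j + 1) = n + 1)
    (e : (relChains S (Rep.trivial K G K)).X (n + 1))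
    (he : (relChains S (Rep.trivial K G K)).d (n + 1) n e = 0)
    (f : (groupCohomology.inhomogeneousCochains A).X i) :
    (groupHomology.inhomogeneousChains A).d (j + 1) j (cap A h (chainPart S e) f) =
      (-1 : K) ^ (i + 1) • (cap A (show i + 1 + j = n + 1 by omega) (chainPart S e)
          ((groupCohomology.inhomogeneousCochains A).d i (i + 1) f) +
        ∑ k, (inclMap S A k).f j (cap (Rep.res (S k).subtype A) (show i + j = n by omega)
          (bdryPart S e k) ((resMap S A k).f i f))) := by
  have key := d_capAbs_fst S A h e he f
  simp only [map_smul] at key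
  rw [← Finset.smul_sum, ← eq_sub_iff_add_eq] at key
  rw [key, pow_succ]
  module

lemma d_capRel_apply {n i j : ℕ} (h : i + (j + 1) = n + 1) (h' : i + 1 + j = n + 1)
    (e : (relChains S (Rep.trivial K G K)).X (n + 1))
    (he : ∀ p, (relChains S (Rep.trivial K G K)).d (n + 1) p e = 0)
    (x : (relCochains S A).X i) :
    (groupHomology.inhomogeneousChains A).d (j + 1) j (capRel S A h e x) =
      (-1 : K) ^ (i + 1) • capRel S A h' e ((relCochains S A).d i (i + 1) x) := by
  have hx : (relCochains S A).d i (i + 1) x = fiberD (resMap S A) i x := by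
    rw [← fiber_d]; rfl
  rw [hx]
  cases i with
  | zero =>
    refine (d_cap_cycle S A h e (he n) x).trans (congrArg (fun t => (-1 : K) ^ (0 + 1) • t) ?_)
    exact (capRel_succ_apply S A h' e _ _).symm
  | succ i =>
    obtain ⟨f, y⟩ : (groupCohomology.inhomogeneousCochains A).X (i + 1) ×
      ∀ k, (groupCohomology.inhomogeneousCochains (Rep.res (S k).subtype A)).X i := x
    obtain ⟨n, rfl⟩ : ∃ n', n = n' + 1 := ⟨i + j, by omega⟩
    have h1 := d_cap_cycle S A h e (he _) f
    have h2 : ∀ k, (groupHomology.inhomogeneousChains A).d (j + 1) j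
        ((inclMap S A k).f (j + 1) (cap (Rep.res (S k).subtype A)
          (show i + (j + 1) = n + 1 by omega) (bdryPart S e k) (y k))) =
      (-1 : K) ^ (i + 1) • (inclMap S A k).f j (cap (Rep.res (S k).subtype A)
          (show i + 1 + j = n + 1 by omega) (bdryPart S e k)
          ((groupCohomology.inhomogeneousCochains (Rep.res (S k).subtype A)).d i (i + 1)
            (y k))) := by
      intro k
      have h3 := d_cap (Rep.res (S k).subtype A) (show i + (j + 1) = n + 1 by omega)
        (bdryPart S e k) (y k)
      rw [relCycle_succ S e (he _) k] at h3
      rw [← comm_apply, groupHomology.inhomogeneousChains.d_def,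
        groupCohomology.inhomogeneousCochains.d_def, ← map_smul]
      refine congrArg ((inclMap S A k).f j) (h3.trans ?_)
      simp only [map_zero, LinearMap.zero_apply, zero_sub, pow_succ]
      module
    rw [fiberD_succ_apply]
    refine (congrArg ((groupHomology.inhomogeneousChains A).d (j + 1) j)
      (capRel_succ_apply S A h e f y)).trans (Eq.trans ?_ (congrArg
        (fun t => (-1 : K) ^ (i + 1 + 1) • t) (capRel_succ_apply S A h' e _ _).symm))
    simp only [map_add, map_sum, map_sub, Finset.sum_sub_distrib]
    rw [h1, Finset.sum_congr rfl fun k _ => h2 k, ← Finset.smul_sum, pow_succ]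
    module

lemma d_capRel {n i j : ℕ} (h : i + (j + 1) = n) (h' : i + 1 + j = n)
    (e : (relChains S (Rep.trivial K G K)).X n)
    (he : ∀ p, (relChains S (Rep.trivial K G K)).d n p e = 0) :
    capRel S A h e ≫ (groupHomology.inhomogeneousChains A).d (j + 1) j =
      (relCochains S A).d i (i + 1) ≫ ((-1 : K) ^ (i + 1) • capRel S A h' e) := by
  obtain ⟨n, rfl⟩ : ∃ n', n = n' + 1 := ⟨i + j, by omega⟩
  refine ModuleCat.hom_ext (LinearMap.ext fun f => ?_)
  exact d_capRel_apply S A h h' e he f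

/-- The cap product `e ∩ • : Hⁱ(G; A) → H_j(G, 𝒮; A)`, `i + j = n`, with the class of a relative
cycle `e` of degree `n` with trivial coefficients. -/
def capAbsHomology {n i j : ℕ} (h : i + j = n) (e : (relChains S (Rep.trivial K G K)).X n)
    (he : ∀ p, (relChains S (Rep.trivial K G K)).d n p e = 0) :
    groupCohomology A i ⟶ relHomology S A j :=
  mapHomology (groupCohomology.inhomogeneousCochains A) (relChains S A) (capAbs S A h e)
    (by
      rintro j rfl
      exact ⟨_, d_capAbs S A h (by omega) e he⟩)
    (by
      rintro i rfl
      refine ⟨(-1 : K) ^ (i + 1) • capAbs S A (by omega) e, ?_⟩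
      rw [Linear.smul_comp, d_capAbs S A (by omega) h e he, Linear.comp_smul, smul_smul,
        ← mul_pow]
      simp)

/-- The cap product `e ∩ • : Hⁱ(G, 𝒮; A) → H_j(G; A)`, `i + j = n`, with the class of a relative
cycle `e` of degree `n` with trivial coefficients. -/
def capRelHomology {n i j : ℕ} (h : i + j = n) (e : (relChains S (Rep.trivial K G K)).X n)
    (he : ∀ p, (relChains S (Rep.trivial K G K)).d n p e = 0) :
    relCohomology S A i ⟶ groupHomology A j :=
  mapHomology (relCochains S A) (groupHomology.inhomogeneousChains A) (capRel S A h e)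
    (by
      rintro j rfl
      exact ⟨_, d_capRel S A h (by omega) e he⟩)
    (by
      rintro i rfl
      refine ⟨(-1 : K) ^ (i + 1) • capRel S A (by omega) e, ?_⟩
      rw [Linear.smul_comp, d_capRel S A (by omega) h e he, Linear.comp_smul, smul_smul,
        ← mul_pow]
      simp)

variable (K) in
/-- `(G, 𝒮)` is a `K`-Poincaré duality pair of dimension `n`: there is a class in `H_n(G, 𝒮; K)`,
represented by a relative cycle `e`, such that for every `K[G]`-module `A` and every integer `i`
the cap products `Hⁱ(G, 𝒮; A) → H_{n-i}(G; A)` and `Hⁱ(G; A) → H_{n-i}(G, 𝒮; A)` with this class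
are isomorphisms. For `i < 0` or `i > n`, where one side is zero by convention, this says that the
other side vanishes. -/
def IsPDPair (n : ℕ) : Prop :=
  ∃ (e : (relChains S (Rep.trivial K G K)).X n)
    (he : ∀ p, (relChains S (Rep.trivial K G K)).d n p e = 0), ∀ A : Rep.{u} K G,
      (∀ (i j : ℕ) (h : i + j = n),
        IsIso (capRelHomology S A h e he) ∧ IsIso (capAbsHomology S A h e he)) ∧
      (∀ i : ℕ, n < i →
        Limits.IsZero (relCohomology S A i) ∧ Limits.IsZero (groupCohomology A i) ∧
        Limits.IsZero (relHomology S A i) ∧ Limits.IsZero (groupHomology A i))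

end Relative

section GroupRing

variable (K G : Type u) [CommRing K] [Group G]

/-- The group ring `K[G]` as a right module over itself, turned into a left `G`-representation
in the usual way: `g` acts by `x ↦ x g⁻¹`. -/
def rightRegular : Rep.{u} K G :=
  Rep.of (X := MonoidAlgebra K G)
    { toFun := fun g => LinearMap.mulRight K (MonoidAlgebra.single g⁻¹ (1 : K))
      map_one' := by
        ext x
        simp [← MonoidAlgebra.one_def]
      map_mul' := fun g h => by
        refine LinearMap.ext fun x => ?_
        simp [mul_assoc, MonoidAlgebra.single_mul_single] }

variable {G} in
/-- Left multiplication by `g` on `K[G]`, an endomorphism of the right module `K[G]`. -/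
def leftMul (g : G) : rightRegular K G ⟶ rightRegular K G :=
  Rep.ofHom
    { toLinearMap := LinearMap.mulLeft K (MonoidAlgebra.single g (1 : K))
      isIntertwining' := fun h => by
        refine LinearMap.ext fun x => ?_
        simp [mul_assoc] }

variable {G} in
lemma leftMul_one : leftMul K (1 : G) = 𝟙 (rightRegular K G) := by
  refine Rep.hom_ext (Representation.IntertwiningMap.ext (LinearMap.ext fun x : MonoidAlgebra K G => ?_))
  change MonoidAlgebra.single (1 : G) (1 : K) * x = x
  rw [← MonoidAlgebra.one_def, one_mul]

variable {G} in
lemma leftMul_mul (g h : G) : leftMul K (g * h) = leftMul K h ≫ leftMul K g := by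
  refine Rep.hom_ext (Representation.IntertwiningMap.ext (LinearMap.ext fun x : MonoidAlgebra K G => ?_))
  change MonoidAlgebra.single (g * h) (1 : K) * x =
    MonoidAlgebra.single g (1 : K) * (MonoidAlgebra.single h (1 : K) * x)
  rw [← mul_assoc, MonoidAlgebra.single_mul_single, mul_one]

/-- `Hⁿ(G; K[G])`, the cohomology being taken with respect to the right module structure of the
bimodule `K[G]`, with the left `G`-action induced by the left module structure of `K[G]`. -/
def groupRingCohomology (n : ℕ) : Rep.{u} K G :=
  Rep.of (X := groupCohomology (rightRegular K G) n)
    { toFun := fun g => (groupCohomology.map (MonoidHom.id G) (leftMul K g) n).hom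
      map_one' := by
        rw [leftMul_one, groupCohomology.map_id]
        rfl
      map_mul' := fun g h => by
        rw [leftMul_mul, groupCohomology.map_id_comp]
        rfl }

end GroupRing

end FoxPairing
end

/-! Duality is used twice. Put `M = H^{n-1}(G; K[G])`. Capping with `e` identifies `H^{n-1}(G, 𝒮;
M)` with `H_1(G; M)`, and also `M` with `H_1(G, 𝒮; K[G])`. The latter isomorphism is natural in the
coefficients, hence equivariant for left multiplication on `K[G]`. What remains is a statement
without duality: `H_1(G; H_1(G, 𝒮; K[G])) ≅ H_2(G, 𝒮; K)`.

For this, let `F_j = C_j(G, 𝒮; K[G])`, a complex of left `G`-representations (`relRep`). Three facts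
carry the argument. (a) `G` permutes a basis of `F_j` freely, so `F_j` has no higher homology
(`isZero_groupHomology_relRep`), and its coinvariants are `C_j(G, 𝒮; K)` (`relAug_eq_zero_iff`). (b)
`K[G]` is free over `G` and over each `S k`, so `F` is exact in degrees at least 2
(`exists_d_eq_relChains_rightRegular`). (c) Since the family is nonempty, `F_1 → F_0` is surjective
(`relChains_d_one_surjective`).

Let `Z` be the kernel of `F_1 → F_0` and `B` the image of `F_2`, so that `M = Z / B`. Dimension
shifting gives `H_1(G; Z) = 0` and an injection `Z_G → (F_1)_G`, so `H_1(G; M)` is the kernel of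
`B_G → (F_1)_G`. Lifted to `F_2`, this kernel consists of the chains whose images in `C_2(G, 𝒮; K)`
are cycles. By (b), such a chain vanishes in `B_G` exactly when its image is a boundary. Thus
`H_1(G; M)` and `H_2(G, 𝒮; K)` are quotients of one module by the same kernel. -/

noncomputable section

namespace FoxPairing

/-! ### Vanishing of higher homology for coefficients with a freely permuted basis -/

section Acyclic

variable {K H : Type u} [CommRing K] [Group H] (A : Rep.{u} K H)

/-- Prepending the group component of `θ` to a bar chain. -/
def prepend (θ : A →ₗ[K] (H →₀ A)) (n : ℕ) :
    ((Fin n → H) →₀ A) →ₗ[K] ((Fin (n + 1) → H) →₀ A) :=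
  Finsupp.lsum K fun g => Finsupp.lmapDomain A K (fun x => Fin.cons x g) ∘ₗ θ

lemma prepend_single (θ : A →ₗ[K] (H →₀ A)) (n : ℕ) (g : Fin n → H) (a : A) :
    prepend A θ n (Finsupp.single g a) =
      Finsupp.mapDomain (fun x => (Fin.cons x g : Fin (n + 1) → H)) (θ a) := by
  simp [prepend]

lemma contractNth_zero_cons {n : ℕ} (x : H) (g : Fin (n + 1) → H) :
    Fin.contractNth 0 (· * ·) (Fin.cons x g : Fin (n + 2) → H) =
      Fin.cons (x * g 0) (fun i => g i.succ) := by
  funext j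
  refine Fin.cases ?_ (fun j => ?_) j
  · simp [Fin.contractNth]
  · rw [Fin.contractNth_apply_of_gt _ _ _ _ (by simp)]
    simp

lemma contractNth_succ_cons {n : ℕ} (x : H) (g : Fin (n + 1) → H) (k : Fin (n + 1)) :
    Fin.contractNth k.succ (· * ·) (Fin.cons x g : Fin (n + 2) → H) =
      Fin.cons x (Fin.contractNth k (· * ·) g) := by
  funext j
  refine Fin.cases ?_ (fun j => ?_) j
  · simp [Fin.contractNth]
  · simp [Fin.contractNth]

lemma d_mapDomain_cons {n : ℕ} (g : Fin (n + 1) → H) (t : H →₀ A) :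
    groupHomology.inhomogeneousChains.d A (n + 1)
        (Finsupp.mapDomain (fun x => (Fin.cons x g : Fin (n + 2) → H)) t) =
      Finsupp.single g (t.sum fun x a => A.ρ x⁻¹ a) -
        Finsupp.mapDomain (fun x => (Fin.cons (x * g 0) (fun i => g i.succ) : Fin (n + 1) → H)) t -
        ∑ k : Fin (n + 1), (-1 : K) ^ ((k : ℕ) + 1) •
          Finsupp.mapDomain (fun x => (Fin.cons x (Fin.contractNth k (· * ·) g) :
            Fin (n + 1) → H)) t := by
  induction t using Finsupp.induction_linear with
  | zero => simp
  | add t t' ht ht' =>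
    rw [Finsupp.mapDomain_add, map_add, ht, ht', Finsupp.sum_add_index' (by simp) (by simp)]
    simp only [Finsupp.mapDomain_add, Finsupp.single_add, smul_add, Finset.sum_add_distrib]
    abel
  | single x a =>
    simp only [Finsupp.mapDomain_single]
    rw [groupHomology.inhomogeneousChains.d_single, Finsupp.sum_single_index (by simp),
      Fin.sum_univ_succ]
    simp only [contractNth_zero_cons, contractNth_succ_cons, Fin.cons_zero, Fin.cons_succ,
      Fin.val_zero, Fin.val_succ, zero_add, pow_one, neg_smul, one_smul]
    rw [sub_eq_add_neg, sub_eq_add_neg, ← Finset.sum_neg_distrib, add_assoc]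
    congr 2
    refine Finset.sum_congr rfl fun k _ => ?_
    rw [pow_succ _ ((k : ℕ) + 1)]
    module

/-- A contracting homotopy from a splitting `θ` of the action map `∑ x ⊗ a ↦ ∑ x⁻¹ a`. In the
boundary of a prepended chain, the first face returns the chain because `θ` is a section (`hs`), the
next face cancels against the first face of the original chain by equivariance (`hθ`), and the other
faces cancel in pairs. -/
lemma d_prepend_add {θ : A →ₗ[K] (H →₀ A)}
    (hθ : ∀ (h : H) (a : A), θ (A.ρ h⁻¹ a) = Finsupp.mapDomain (· * h) (θ a))
    (hs : ∀ a : A, ((θ a).sum fun x b => A.ρ x⁻¹ b) = a) {n : ℕ} (c : (Fin (n + 1) → H) →₀ A) :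
    groupHomology.inhomogeneousChains.d A (n + 1) (prepend A θ (n + 1) c) +
      prepend A θ n (groupHomology.inhomogeneousChains.d A n c) = c := by
  induction c using Finsupp.induction_linear with
  | zero => simp
  | add c c' hc hc' =>
    rw [map_add, map_add, map_add, map_add]
    nth_rw 3 [← hc]
    nth_rw 3 [← hc']
    abel
  | single g a =>
    rw [prepend_single, d_mapDomain_cons, hs, groupHomology.inhomogeneousChains.d_single]
    simp only [map_add, map_sum, map_smul, prepend_single, hθ, ← Finsupp.mapDomain_comp]
    simp only [Function.comp_def]
    abel

/-- A representation with a basis on which the group acts freely has no higher homology. -/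
theorem exists_d_eq_of_basis {X : Type*} (b : Module.Basis X K A) (act : H → X → X)
    (hact : ∀ h x, A.ρ h (b x) = b (act h x)) (τ : X → H)
    (hτ : ∀ h x, τ (act h x) = τ x * h⁻¹) {n : ℕ} (c : (Fin (n + 1) → H) →₀ A)
    (hc : groupHomology.inhomogeneousChains.d A n c = 0) :
    ∃ c', groupHomology.inhomogeneousChains.d A (n + 1) c' = c := by
  -- The label `τ x` records the position of `x` in its free orbit. The value `τ x • b x` is
  -- constant along that orbit, which gives equivariance, and acting by `(τ x)⁻¹` recovers `b x`.
  let θ : A →ₗ[K] (H →₀ A) :=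
    b.constr K fun x => Finsupp.single (τ x) (A.ρ (τ x) (b x))
  have hb : ∀ x, θ (b x) = Finsupp.single (τ x) (A.ρ (τ x) (b x)) := fun x => by simp [θ]
  have hθ : ∀ (h : H) (a : A), θ (A.ρ h⁻¹ a) = Finsupp.mapDomain (· * h) (θ a) := by
    intro h a
    have key : θ ∘ₗ A.ρ h⁻¹ = Finsupp.lmapDomain A K (· * h) ∘ₗ θ := by
      refine b.ext fun x => ?_
      rw [LinearMap.comp_apply, LinearMap.comp_apply, hact, hb, hb, Finsupp.lmapDomain_apply,
        Finsupp.mapDomain_single, hτ, inv_inv, ← hact, ← Module.End.mul_apply, ← map_mul]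
      simp
    exact LinearMap.congr_fun key a
  have hs : ∀ a : A, ((θ a).sum fun x b => A.ρ x⁻¹ b) = a := by
    intro a
    have key : (Finsupp.lsum K fun x : H => A.ρ x⁻¹) ∘ₗ θ = LinearMap.id := by
      refine b.ext fun x => ?_
      rw [LinearMap.comp_apply, hb, Finsupp.lsum_single, ← Module.End.mul_apply, ← map_mul]
      simp
    exact LinearMap.congr_fun key a
  refine ⟨prepend A θ (n + 1) c, ?_⟩
  have := d_prepend_add A hθ hs c
  rwa [hc, map_zero, add_zero] at this

end Acyclic

/-! ### Dimension shifting in group homology -/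

section DimensionShift

variable {K G : Type u} [CommRing K] [Group G]

/-- The subrepresentation on a stable submodule, as an object of `Rep K G`. -/
abbrev subRep {A : Rep.{u} K G} (N : Subrepresentation A.ρ) : Rep.{u} K G :=
  Rep.of N.toRepresentation

/-- The inclusion of a subrepresentation. -/
def subRepIncl {A : Rep.{u} K G} (N : Subrepresentation A.ρ) : subRep N ⟶ A :=
  Rep.ofHom ⟨N.toSubmodule.subtype, fun _ => rfl⟩

/-- The kernel of a morphism of representations, as a subrepresentation. -/
def kerSubrep {A B : Rep.{u} K G} (f : A ⟶ B) : Subrepresentation A.ρ where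
  toSubmodule := LinearMap.ker f.hom.toLinearMap
  apply_mem_toSubmodule g v hv := by
    have hv' : f.hom v = 0 := hv
    change f.hom (A.ρ g v) = 0
    rw [Rep.hom_comm_apply, hv', map_zero]

/-- Corestriction of a morphism to a kernel. -/
def liftKer {A B C : Rep.{u} K G} (f : A ⟶ B) (g : C ⟶ A) (h : ∀ x, f.hom (g.hom x) = 0) :
    C ⟶ subRep (kerSubrep f) :=
  Rep.ofHom ⟨g.hom.toLinearMap.codRestrict _ h, fun s => by
    refine LinearMap.ext fun x => Subtype.ext ?_
    exact Rep.hom_comm_apply g s x⟩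

lemma shortExact_of_injective_surjective {A B C : Rep.{u} K G} (f : A ⟶ B) (g : B ⟶ C)
    (w : f ≫ g = 0) (hf : Function.Injective f.hom) (hg : Function.Surjective g.hom)
    (h : ∀ b, g.hom b = 0 → ∃ a, f.hom a = b) : (ShortComplex.mk f g w).ShortExact where
  exact := by
    refine (forget₂ (Rep.{u} K G) (ModuleCat.{u} K)).reflects_exact_of_faithful _ ?_
    rw [ShortComplex.moduleCat_exact_iff]
    exact h
  mono_f := (Rep.mono_iff_injective f).2 hf
  epi_g := (Rep.epi_iff_surjective g).2 hg

lemma shortExact_ker {A B : Rep.{u} K G} (f : A ⟶ B) (hf : Function.Surjective f.hom) :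
    (ShortComplex.mk (subRepIncl (kerSubrep f)) f (Rep.hom_ext
      (Representation.IntertwiningMap.ext (LinearMap.ext fun x => x.2)))).ShortExact :=
  shortExact_of_injective_surjective _ _ _ Subtype.val_injective hf fun b hb => ⟨⟨b, hb⟩, rfl⟩

lemma H0π_surjective (A : Rep.{u} K G) : Function.Surjective (groupHomology.H0π A) :=
  (ModuleCat.epi_iff_surjective _).1 inferInstance

lemma H0π_eq_zero_iff (A : Rep.{u} K G) (x : A) :
    groupHomology.H0π A x = 0 ↔ x ∈ Representation.Coinvariants.ker A.ρ := by
  rw [← Representation.Coinvariants.mk_eq_zero]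
  have h : (groupHomology.H0Iso A).hom (groupHomology.H0π A x) =
      Representation.Coinvariants.mk A.ρ x :=
    congrArg (fun t => t.hom x) (groupHomology.H0π_comp_H0Iso_hom A)
  rw [← h]
  exact ((groupHomology.H0Iso A).toLinearEquiv.map_eq_zero_iff).symm

lemma map_H0π {A B : Rep.{u} K G} (f : A ⟶ B) (x : A) :
    groupHomology.map (MonoidHom.id G) f 0 (groupHomology.H0π A x) =
      groupHomology.H0π B (f.hom x) :=
  congrArg (fun t => t.hom x) (groupHomology.H0π_comp_map (MonoidHom.id G) f)

lemma injective_of_exact_of_isZero {S : ShortComplex (ModuleCat.{u} K)} (h : S.Exact)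
    (h0 : Limits.IsZero S.X₁) : Function.Injective S.g :=
  (ModuleCat.mono_iff_injective _).1 (h.mono_g (h0.eq_of_src _ _))

lemma map_injective_of_isZero {X : ShortComplex (Rep.{u} K G)} (hX : X.ShortExact) (i : ℕ)
    (h : Limits.IsZero (groupHomology X.X₃ (i + 1))) :
    Function.Injective (groupHomology.map (MonoidHom.id G) X.f i) :=
  injective_of_exact_of_isZero
    (groupHomology.mapShortComplex₁_exact hX (i := i + 1) (j := i) rfl) h

lemma δ_injective_of_isZero {X : ShortComplex (Rep.{u} K G)} (hX : X.ShortExact) (i : ℕ)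
    (h : Limits.IsZero (groupHomology X.X₂ (i + 1))) :
    Function.Injective (groupHomology.δ hX (i + 1) i rfl) :=
  injective_of_exact_of_isZero
    (groupHomology.mapShortComplex₃_exact hX (i := i + 1) (j := i) rfl) h

lemma map_eq_zero_iff_exists_δ {X : ShortComplex (Rep.{u} K G)} (hX : X.ShortExact) (i : ℕ)
    (y : groupHomology X.X₁ i) :
    groupHomology.map (MonoidHom.id G) X.f i y = 0 ↔
      ∃ x, groupHomology.δ hX (i + 1) i rfl x = y :=
  (ShortComplex.ShortExact.moduleCat_exact_iff_function_exact _).1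
    (groupHomology.mapShortComplex₁_exact hX (i := i + 1) (j := i) rfl) y

/-- The map is `δ⁻¹ ∘ ψ`, defined on `L`, the preimage under `ψ` of the range of `δ`. It presents
`X` as a subquotient of `P` given by explicit elements. -/
lemma exists_surjective_of_injective {R P X Y : Type*} [CommRing R] [AddCommGroup P]
    [AddCommGroup X] [AddCommGroup Y] [Module R P] [Module R X] [Module R Y] {δ : X →ₗ[R] Y}
    (hδ : Function.Injective δ) {ψ : P →ₗ[R] Y} (hψ : Function.Surjective ψ) {L : Submodule R P}
    (h : ∀ p, p ∈ L ↔ ∃ x, δ x = ψ p) :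
    ∃ Φ : L →ₗ[R] X, Function.Surjective Φ ∧ ∀ p, Φ p = 0 ↔ ψ p = 0 := by
  let e := LinearEquiv.ofInjective δ hδ
  refine ⟨e.symm.toLinearMap ∘ₗ (ψ ∘ₗ L.subtype).codRestrict (LinearMap.range δ)
    fun p => (h p.1).1 p.2, ?_, fun p => ?_⟩
  · refine e.symm.surjective.comp ?_
    rintro ⟨y, hy⟩
    obtain ⟨p, rfl⟩ := hψ y
    exact ⟨⟨p, (h p).2 hy⟩, rfl⟩
  · rw [LinearMap.comp_apply, LinearEquiv.coe_coe, LinearEquiv.map_eq_zero_iff]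
    exact Subtype.ext_iff

/-- In the long exact sequence the connecting map is injective because the homology of the middle
term vanishes, and its image is the kernel of the next map. Generators of `H_i(X₁)` therefore yield
generators of `H_{i+1}(X₃)`. -/
lemma exists_surjective_groupHomology {X : ShortComplex (Rep.{u} K G)} (hX : X.ShortExact)
    (i : ℕ) (h : Limits.IsZero (groupHomology X.X₂ (i + 1))) {P : Type*} [AddCommGroup P]
    [Module K P] {ψ : P →ₗ[K] groupHomology X.X₁ i} (hψ : Function.Surjective ψ)
    {L : Submodule K P}
    (hL : ∀ p, p ∈ L ↔ groupHomology.map (MonoidHom.id G) X.f i (ψ p) = 0) :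
    ∃ Φ : L →ₗ[K] groupHomology X.X₃ (i + 1), Function.Surjective Φ ∧
      ∀ p, Φ p = 0 ↔ ψ p = 0 :=
  exists_surjective_of_injective (δ := (groupHomology.δ hX (i + 1) i rfl).hom)
    (δ_injective_of_isZero hX i h) hψ fun p =>
      (hL p).trans (map_eq_zero_iff_exists_δ hX i (ψ p))

/-- Each generator `g b - b` lifts to `g q - q` for any preimage `q` of `b`. This allows vanishing
in the coinvariants of `B` to be tested on the covering representation. -/
lemma coinvariantsKer_of_surjective {A B : Rep.{u} K G} (f : A ⟶ B)
    (hf : Function.Surjective f.hom) :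
    Representation.Coinvariants.ker B.ρ =
      (Representation.Coinvariants.ker A.ρ).map f.hom.toLinearMap := by
  rw [Representation.Coinvariants.ker, Representation.Coinvariants.ker, Submodule.map_span]
  congr 1
  ext b
  constructor
  · rintro ⟨⟨g, b⟩, rfl⟩
    obtain ⟨q, rfl⟩ := hf b
    refine ⟨_, ⟨(g, q), rfl⟩, ?_⟩
    exact (map_sub _ _ _).trans (congrArg (fun t => t - f.hom q) (Rep.hom_comm_apply f g q))
  · rintro ⟨_, ⟨⟨g, q⟩, rfl⟩, rfl⟩
    refine ⟨(g, f.hom q), ?_⟩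
    exact ((map_sub _ _ _).trans (congrArg (fun t => t - f.hom q) (Rep.hom_comm_apply f g q))).symm

lemma exists_surjective_of_shortExact {B Z M P₂ P₁ P₀ : Rep.{u} K G} {j : B ⟶ Z} {π : Z ⟶ M}
    {wB : j ≫ π = 0} (sesB : (ShortComplex.mk j π wB).ShortExact) {i : Z ⟶ P₁} {d₁ : P₁ ⟶ P₀}
    {wZ : i ≫ d₁ = 0} (sesZ : (ShortComplex.mk i d₁ wZ).ShortExact) (dB : P₂ ⟶ B)
    (hdB : Function.Surjective dB.hom)
    (h₁ : Limits.IsZero (groupHomology P₁ 1)) (h₀ : Limits.IsZero (groupHomology P₀ 1))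
    (h₀' : Limits.IsZero (groupHomology P₀ 2)) (L : Submodule K P₂)
    (hL : ∀ p, p ∈ L ↔ i.hom (j.hom (dB.hom p)) ∈ Representation.Coinvariants.ker P₁.ρ) :
    ∃ Φ : L →ₗ[K] groupHomology M 1, Function.Surjective Φ ∧
      ∀ p, Φ p = 0 ↔ ∃ c ∈ Representation.Coinvariants.ker P₂.ρ, dB.hom p = dB.hom c := by
  -- `H_1(Z)` embeds in `H_1(P₁) = 0` because `H_2(P₀) = 0`.
  have hZ1 : Limits.IsZero (groupHomology Z 1) := by
    rw [ModuleCat.isZero_iff_subsingleton] at h₁ ⊢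
    exact (map_injective_of_isZero sesZ 1 h₀').subsingleton
  -- Since `H_1(P₀) = 0`, vanishing in the coinvariants of `Z` can be tested in those of `P₁`, which
  -- is where `L` is defined.
  have hinjZ : Function.Injective (groupHomology.map (MonoidHom.id G) i 0) :=
    map_injective_of_isZero sesZ 0 h₀
  obtain ⟨Φ, hΦ, hΦ'⟩ := exists_surjective_groupHomology sesB 0 hZ1
    (ψ := (groupHomology.H0π B).hom ∘ₗ dB.hom.toLinearMap) ((H0π_surjective _).comp hdB)
    (L := L) (fun p => by
      rw [hL, ← H0π_eq_zero_iff, ← map_H0π, map_eq_zero_iff _ hinjZ, ← map_H0π]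
      rfl)
  refine ⟨Φ, hΦ, fun p => (hΦ' p).trans ((H0π_eq_zero_iff B (dB.hom p)).trans ?_)⟩
  rw [coinvariantsKer_of_surjective dB hdB, Submodule.mem_map]
  exact exists_congr fun c => and_congr_right fun _ => eq_comm

/-- Given `P₂ → Z → M → 0` exact and `0 → Z → P₁ → P₀ → 0` short exact with `P₁`, `P₀` acyclic in
the relevant degrees, `H₁(G; M)` is a quotient of the chains of `P₂` whose boundary vanishes in the
coinvariants of `P₁`. -/
theorem exists_surjective_groupHomology_one {P₂ P₁ P₀ M : Rep.{u} K G} (d₁ : P₁ ⟶ P₀)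
    (hd₁ : Function.Surjective d₁.hom) (d₂ : P₂ ⟶ subRep (kerSubrep d₁))
    (π : subRep (kerSubrep d₁) ⟶ M) (hπ : Function.Surjective π.hom)
    (hπd : ∀ z, π.hom z = 0 ↔ ∃ p, d₂.hom p = z)
    (h₁ : Limits.IsZero (groupHomology P₁ 1)) (h₀ : Limits.IsZero (groupHomology P₀ 1))
    (h₀' : Limits.IsZero (groupHomology P₀ 2)) (L : Submodule K P₂)
    (hL : ∀ p, p ∈ L ↔ (d₂.hom p).1 ∈ Representation.Coinvariants.ker P₁.ρ) :
    ∃ Φ : L →ₗ[K] groupHomology M 1, Function.Surjective Φ ∧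
      ∀ p, Φ p = 0 ↔ ∃ c ∈ Representation.Coinvariants.ker P₂.ρ, d₂.hom p = d₂.hom c := by
  obtain ⟨Φ, hΦ, hΦ'⟩ := exists_surjective_of_shortExact (shortExact_ker π hπ)
    (shortExact_ker d₁ hd₁) (liftKer π d₂ fun x => (hπd _).2 ⟨x, rfl⟩)
    (fun b => by
      obtain ⟨p, hp⟩ := (hπd b.1).1 b.2
      exact ⟨p, Subtype.ext hp⟩) h₁ h₀ h₀' L hL
  exact ⟨Φ, hΦ, fun p => (hΦ' p).trans (exists_congr fun c => and_congr_right fun _ =>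
    Subtype.ext_iff)⟩

end DimensionShift

/-! ### Cycles and homology classes in terms of elements -/

section Homology

variable {K : Type u} [CommRing K] {ι : Type} {c : ComplexShape ι}

lemma homologyπ_surjective (C : HomologicalComplex (ModuleCat.{u} K) c) (i : ι) :
    Function.Surjective (C.homologyπ i) :=
  (ModuleCat.epi_iff_surjective _).1 inferInstance

lemma homologyπ_eq_zero_iff (C : HomologicalComplex (ModuleCat.{u} K) c) {i j : ι}
    (hij : c.prev j = i) (z : C.cycles j) :
    C.homologyπ j z = 0 ↔ ∃ y, C.d i j y = C.iCycles j z := by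
  have h := (ShortComplex.exact_of_g_is_cokernel
    (ShortComplex.mk _ _ (C.toCycles_comp_homologyπ i j)) (C.homologyIsCokernel i j hij))
  have h' := (ShortComplex.ShortExact.moduleCat_exact_iff_function_exact _).1 h z
  refine h'.trans (exists_congr fun y => ?_)
  rw [← C.toCycles_i, ModuleCat.comp_apply]
  exact ((ModuleCat.mono_iff_injective (C.iCycles j)).1 inferInstance).eq_iff.symm

/-- An element of the kernel of the differential, as a cycle. -/
def toCycle (C : HomologicalComplex (ModuleCat.{u} K) c) {j k : ι} (hjk : c.next j = k) :
    LinearMap.ker (C.d j k).hom →ₗ[K] C.cycles j :=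
  (C.liftCycles (ModuleCat.ofHom (LinearMap.ker (C.d j k).hom).subtype) k hjk
    (ModuleCat.hom_ext (LinearMap.ext fun x => x.2))).hom

lemma iCycles_toCycle (C : HomologicalComplex (ModuleCat.{u} K) c) {j k : ι}
    (hjk : c.next j = k) (x : LinearMap.ker (C.d j k).hom) :
    C.iCycles j (toCycle C hjk x) = x.1 :=
  LinearMap.congr_fun (congrArg ModuleCat.Hom.hom (C.liftCycles_i
    (ModuleCat.ofHom (LinearMap.ker (C.d j k).hom).subtype) k hjk
    (ModuleCat.hom_ext (LinearMap.ext fun x => x.2)))) x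

lemma iCycles_injective (C : HomologicalComplex (ModuleCat.{u} K) c) (j : ι) :
    Function.Injective (C.iCycles j) :=
  (ModuleCat.mono_iff_injective (C.iCycles j)).1 inferInstance

/-- The homology class of a cycle. -/
def homologyClass (C : HomologicalComplex (ModuleCat.{u} K) c) {j k : ι} (hjk : c.next j = k) :
    LinearMap.ker (C.d j k).hom →ₗ[K] C.homology j :=
  (C.homologyπ j).hom ∘ₗ toCycle C hjk

lemma homologyClass_eq_zero_iff (C : HomologicalComplex (ModuleCat.{u} K) c) {i j k : ι}
    (hij : c.prev j = i) (hjk : c.next j = k) (x : LinearMap.ker (C.d j k).hom) :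
    homologyClass C hjk x = 0 ↔ ∃ y, C.d i j y = x.1 := by
  rw [← iCycles_toCycle C hjk x]
  exact homologyπ_eq_zero_iff C hij _

lemma homologyClass_surjective (C : HomologicalComplex (ModuleCat.{u} K) c) {j k : ι}
    (hjk : c.next j = k) : Function.Surjective (homologyClass C hjk) := by
  intro y
  obtain ⟨z, rfl⟩ := homologyπ_surjective C j y
  have hz : C.d j k (C.iCycles j z) = 0 :=
    congrArg (fun t => t.hom z) (C.iCycles_d j k)
  exact ⟨⟨C.iCycles j z, hz⟩, congrArg (C.homologyπ j)
    (iCycles_injective C j (iCycles_toCycle C hjk ⟨C.iCycles j z, hz⟩))⟩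

lemma homologyMap_homologyClass {C D : HomologicalComplex (ModuleCat.{u} K) c} (φ : C ⟶ D)
    {j k : ι} (hjk : c.next j = k) (x : LinearMap.ker (C.d j k).hom)
    (y : LinearMap.ker (D.d j k).hom) (hxy : φ.f j x.1 = y.1) :
    HomologicalComplex.homologyMap φ j (homologyClass C hjk x) = homologyClass D hjk y := by
  refine (congrArg (fun t => t.hom (toCycle C hjk x))
    (HomologicalComplex.homologyπ_naturality φ j)).trans ?_
  refine congrArg (D.homologyπ j) (iCycles_injective D j ?_)
  refine Eq.trans ?_ (iCycles_toCycle D hjk y).symm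
  rw [← hxy, ← iCycles_toCycle C hjk x]
  exact congrArg (fun t => t.hom (toCycle C hjk x)) (HomologicalComplex.cyclesMap_i φ j)

lemma isZero_homology_of_exact (C : HomologicalComplex (ModuleCat.{u} K) c) {i j k : ι}
    (hij : c.prev j = i) (hjk : c.next j = k)
    (h : ∀ x, C.d j k x = 0 → ∃ y, C.d i j y = x) : Limits.IsZero (C.homology j) := by
  rw [ModuleCat.isZero_iff_subsingleton]
  refine subsingleton_of_forall_eq 0 fun y => ?_
  obtain ⟨x, rfl⟩ := homologyClass_surjective C hjk y
  exact (homologyClass_eq_zero_iff C hij hjk x).2 (h x.1 x.2)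

end Homology

/-! ### Functoriality of mapping cones -/

section ConeMap

variable {K : Type u} [CommRing K] {m : ℕ} {C C' : Fin m → ChainComplex (ModuleCat.{u} K) ℕ}
  {D D' : ChainComplex (ModuleCat.{u} K) ℕ}

/-- The components of the map between mapping cones. -/
def coneMapX (a : D ⟶ D') (b : ∀ k, C k ⟶ C' k) : ∀ n : ℕ, coneX C D n ⟶ coneX C' D' n
  | 0 => a.f 0
  | n + 1 => ModuleCat.ofHom (X := D.X (n + 1) × ∀ k, (C k).X n)
      (Y := D'.X (n + 1) × ∀ k, (C' k).X n)
      ((a.f (n + 1)).hom.prodMap (LinearMap.pi fun k => ((b k).f n).hom ∘ₗ LinearMap.proj k))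

lemma coneMapX_succ_apply (a : D ⟶ D') (b : ∀ k, C k ⟶ C' k) (n : ℕ)
    (x : D.X (n + 1) × ∀ k, (C k).X n) :
    coneMapX a b (n + 1) x = ((a.f (n + 1) x.1, fun k => (b k).f n (x.2 k)) :
      D'.X (n + 1) × ∀ k, (C' k).X n) := rfl

lemma coneMapX_comm {φ : ∀ k, C k ⟶ D} {φ' : ∀ k, C' k ⟶ D'} (a : D ⟶ D')
    (b : ∀ k, C k ⟶ C' k) (h : ∀ k, φ k ≫ a = b k ≫ φ' k) (n : ℕ) :
    coneMapX a b (n + 1) ≫ coneD φ' n = coneD φ n ≫ coneMapX a b n := by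
  have h' : ∀ k n x, (φ' k).f n ((b k).f n x) = a.f n ((φ k).f n x) := fun k n x =>
    (congrArg (fun t : C k ⟶ D' => (t.f n).hom x) (h k)).symm
  refine ModuleCat.hom_ext (LinearMap.ext fun x => ?_)
  obtain ⟨z, w⟩ : D.X (n + 1) × ∀ k, (C k).X n := x
  change coneD φ' n (coneMapX a b (n + 1) (z, w)) = coneMapX a b n (coneD φ n (z, w))
  rw [coneMapX_succ_apply]
  cases n with
  | zero =>
    rw [coneD_zero_apply, coneD_zero_apply]
    change _ = a.f 0 _
    simp only [map_add, map_sum, comm_apply, h']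
  | succ n =>
    rw [coneD_succ_apply, coneD_succ_apply, coneMapX_succ_apply]
    simp only [map_add, map_sum, map_neg, comm_apply, h']
    rfl

/-- The map between mapping cones. -/
def coneMap {φ : ∀ k, C k ⟶ D} {φ' : ∀ k, C' k ⟶ D'} (a : D ⟶ D') (b : ∀ k, C k ⟶ C' k)
    (h : ∀ k, φ k ≫ a = b k ≫ φ' k) : cone φ ⟶ cone φ' :=
  ChainComplex.ofHom (coneMapX a b) fun n => by
    rw [cone_d, cone_d]
    exact coneMapX_comm a b h n

end ConeMap

/-! ### Relative chains as a functor of the coefficients, and their bases -/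

section RelMap

variable {K G : Type u} [CommRing K] [Group G] {m : ℕ} (S : Fin m → Subgroup G)

/-- Restriction of a morphism of representations to a subgroup. -/
abbrev resHom {A B : Rep.{u} K G} (f : A ⟶ B) (k : Fin m) :
    Rep.res (S k).subtype A ⟶ Rep.res (S k).subtype B :=
  (Rep.resFunctor (S k).subtype).map f

/-- The map of relative chains induced by a morphism of coefficients. -/
def relChainsMap {A B : Rep.{u} K G} (f : A ⟶ B) : relChains S A ⟶ relChains S B :=
  coneMap (groupHomology.chainsMap (MonoidHom.id G) f)
    (fun k => groupHomology.chainsMap (MonoidHom.id (S k)) (resHom S f k))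
    (fun k => by
      rw [← groupHomology.chainsMap_comp, ← groupHomology.chainsMap_comp]
      rfl)

lemma relChainsMap_zero_apply {A B : Rep.{u} K G} (f : A ⟶ B)
    (x : (groupHomology.inhomogeneousChains A).X 0) :
    (relChainsMap S f).f 0 x = (groupHomology.chainsMap (MonoidHom.id G) f).f 0 x := rfl

lemma relChainsMap_succ_apply {A B : Rep.{u} K G} (f : A ⟶ B) (n : ℕ)
    (x : (groupHomology.inhomogeneousChains A).X (n + 1) ×
      ∀ k, (groupHomology.inhomogeneousChains (Rep.res (S k).subtype A)).X n) :
    (relChainsMap S f).f (n + 1) x =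
      (((groupHomology.chainsMap (MonoidHom.id G) f).f (n + 1) x.1, fun k =>
        (groupHomology.chainsMap (MonoidHom.id (S k)) (resHom S f k)).f n (x.2 k)) :
      (groupHomology.inhomogeneousChains B).X (n + 1) ×
        ∀ k, (groupHomology.inhomogeneousChains (Rep.res (S k).subtype B)).X n) := rfl

/-- The index type of the basis of relative chains of degree `n` coming from a basis of the
coefficients indexed by `ι`. -/
def RelIndex (ι : Type u) : ℕ → Type u
  | 0 => Σ _ : Fin 0 → G, ι
  | n + 1 => (Σ _ : Fin (n + 1) → G, ι) ⊕ (Σ k : Fin m, Σ _ : Fin n → S k, ι)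

/-- Functoriality of the index type. -/
def RelIndex.map {ι κ : Type u} (t : ι → κ) : ∀ {n : ℕ}, RelIndex S ι n → RelIndex S κ n
  | 0, x => ⟨x.1, t x.2⟩
  | _ + 1, .inl x => .inl ⟨x.1, t x.2⟩
  | _ + 1, .inr x => .inr ⟨x.1, x.2.1, t x.2.2⟩

/-- The coefficient component of an index. -/
def RelIndex.coeff {ι : Type u} : ∀ {n : ℕ}, RelIndex S ι n → ι
  | 0, x => x.2
  | _ + 1, .inl x => x.2
  | _ + 1, .inr x => x.2.2

lemma RelIndex.map_map {ι κ μ : Type u} (t : ι → κ) (s : κ → μ) {n : ℕ} (x : RelIndex S ι n) :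
    RelIndex.map S s (RelIndex.map S t x) = RelIndex.map S (s ∘ t) x := by
  match n, x with
  | 0, x => rfl
  | _ + 1, .inl x => rfl
  | _ + 1, .inr x => rfl

/-- An index carries a single coefficient label, so only the value there matters. This lets a
constant relabelling be replaced by a translation that depends on the index. -/
lemma RelIndex.map_congr {ι κ : Type u} {t s : ι → κ} {n : ℕ} {x : RelIndex S ι n}
    (h : t (RelIndex.coeff S x) = s (RelIndex.coeff S x)) :
    RelIndex.map S t x = RelIndex.map S s x := by
  match n, x with
  | 0, x => exact congrArg (Sigma.mk x.1) h
  | _ + 1, .inl x => exact congrArg (fun y => (Sum.inl ⟨x.1, y⟩ : RelIndex S κ (_ + 1))) h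
  | _ + 1, .inr x => exact congrArg (fun y => (Sum.inr ⟨x.1, x.2.1, y⟩ : RelIndex S κ (_ + 1))) h

lemma RelIndex.map_id {ι : Type u} {n : ℕ} (x : RelIndex S ι n) : RelIndex.map S id x = x := by
  match n, x with
  | 0, x => rfl
  | _ + 1, .inl x => rfl
  | _ + 1, .inr x => rfl

lemma RelIndex.coeff_map {ι κ : Type u} (t : ι → κ) {n : ℕ} (x : RelIndex S ι n) :
    RelIndex.coeff S (RelIndex.map S t x) = t (RelIndex.coeff S x) := by
  match n, x with
  | 0, x => rfl
  | _ + 1, .inl x => rfl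
  | _ + 1, .inr x => rfl

/-- The basis of the relative chains coming from a basis of the coefficients. -/
def relBasis {A : Rep.{u} K G} {ι : Type u} (b : Module.Basis ι K A) :
    ∀ n : ℕ, Module.Basis (RelIndex S ι n) K ((relChains S A).X n)
  | 0 => (Finsupp.basis fun _ : Fin 0 → G => b : Module.Basis (Σ _ : Fin 0 → G, ι) K _)
  | n + 1 => ((Finsupp.basis fun _ : Fin (n + 1) → G => b :
        Module.Basis (Σ _ : Fin (n + 1) → G, ι) K _).prod
      (Pi.basis fun k => (Finsupp.basis fun _ : Fin n → S k => b :
        Module.Basis (Σ _ : Fin n → S k, ι) K _)))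

lemma relBasis_zero_apply {A : Rep.{u} K G} {ι : Type u} (b : Module.Basis ι K A)
    (x : Σ _ : Fin 0 → G, ι) :
    relBasis S b 0 x = (Finsupp.single x.1 (b x.2) : (Fin 0 → G) →₀ A) :=
  congrFun (Finsupp.coe_basis _) x

lemma relBasis_inl_apply {A : Rep.{u} K G} {ι : Type u} (b : Module.Basis ι K A) (n : ℕ)
    (x : Σ _ : Fin (n + 1) → G, ι) :
    relBasis S b (n + 1) (Sum.inl x) = ((Finsupp.single x.1 (b x.2), 0) :
      ((Fin (n + 1) → G) →₀ A) × ∀ k, ((Fin n → S k) →₀ A)) := by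
  refine (Module.Basis.prod_apply _ _ _).trans ?_
  refine Prod.ext ?_ rfl
  exact congrFun (Finsupp.coe_basis _) x

lemma relBasis_inr_apply {A : Rep.{u} K G} {ι : Type u} (b : Module.Basis ι K A) (n : ℕ)
    (x : Σ k : Fin m, Σ _ : Fin n → S k, ι) :
    relBasis S b (n + 1) (Sum.inr x) =
      ((0, Pi.single x.1 (Finsupp.single x.2.1 (b x.2.2))) :
      ((Fin (n + 1) → G) →₀ A) × ∀ k, ((Fin n → S k) →₀ A)) := by
  refine (Module.Basis.prod_apply _ _ _).trans ?_
  refine Prod.ext rfl ?_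
  refine (Pi.basis_apply _ _).trans ?_
  exact congrArg (Pi.single x.1) (congrFun (Finsupp.coe_basis _) x.2)

/-- Left multiplications and the augmentation both send basis elements of `K[G]` to basis elements.
On relative chains they thus become relabellings of indices, which reduces freeness and coinvariants
to combinatorics. -/
lemma relChainsMap_relBasis {A B : Rep.{u} K G} (f : A ⟶ B) {ι κ : Type u}
    (b : Module.Basis ι K A) (c : Module.Basis κ K B) (t : ι → κ)
    (h : ∀ i, f.hom (b i) = c (t i)) {n : ℕ} (x : RelIndex S ι n) :
    (relChainsMap S f).f n (relBasis S b n x) = relBasis S c n (RelIndex.map S t x) := by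
  match n, x with
  | 0, x =>
    erw [relBasis_zero_apply, relChainsMap_zero_apply, groupHomology.chainsMap_f_single]
    rw [h]
    exact (relBasis_zero_apply S c ⟨x.1, t x.2⟩).symm
  | n + 1, .inl x =>
    rw [relBasis_inl_apply]
    refine (relChainsMap_succ_apply S f n _).trans ?_
    refine Eq.trans ?_ (relBasis_inl_apply S c n ⟨x.1, t x.2⟩).symm
    refine Prod.ext ?_ (funext fun k => map_zero _)
    refine (groupHomology.chainsMap_f_single _ _ _ _ _).trans ?_
    rw [h]
    rfl
  | n + 1, .inr x =>
    rw [relBasis_inr_apply]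
    refine (relChainsMap_succ_apply S f n _).trans ?_
    refine Eq.trans ?_ (relBasis_inr_apply S c n ⟨x.1, x.2.1, t x.2.2⟩).symm
    refine Prod.ext (map_zero _) (funext fun k => ?_)
    obtain ⟨l, g, i⟩ := x
    dsimp only
    by_cases hk : k = l
    · subst hk
      rw [Pi.single_eq_same, Pi.single_eq_same]
      refine (groupHomology.chainsMap_f_single _ _ _ _ _).trans ?_
      rw [← h]
      rfl
    · rw [Pi.single_eq_of_ne hk, Pi.single_eq_of_ne hk, map_zero]

lemma relChainsMap_id (A : Rep.{u} K G) : relChainsMap S (𝟙 A) = 𝟙 (relChains S A) := by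
  ext n x
  match n, x with
  | 0, x =>
    exact congrArg (fun t : groupHomology.inhomogeneousChains A ⟶ _ => (t.f 0).hom x)
      (groupHomology.chainsMap_id (A := A))
  | n + 1, x =>
    refine (relChainsMap_succ_apply S _ n x).trans (Prod.ext ?_ (funext fun k => ?_))
    · exact congrArg (fun t : groupHomology.inhomogeneousChains A ⟶ _ => (t.f (n + 1)).hom x.1)
        (groupHomology.chainsMap_id (A := A))
    · exact congrArg (fun t : groupHomology.inhomogeneousChains (Rep.res (S k).subtype A) ⟶ _ =>
        (t.f n).hom (x.2 k)) (groupHomology.chainsMap_id (A := Rep.res (S k).subtype A))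

lemma relChainsMap_comp {A B C : Rep.{u} K G} (f : A ⟶ B) (g : B ⟶ C) :
    relChainsMap S (f ≫ g) = relChainsMap S f ≫ relChainsMap S g := by
  ext n x
  match n, x with
  | 0, x =>
    exact congrArg (fun t : groupHomology.inhomogeneousChains A ⟶ _ => (t.f 0).hom x)
      (groupHomology.chainsMap_id_comp f g)
  | n + 1, x =>
    refine (relChainsMap_succ_apply S _ n x).trans (Prod.ext ?_ (funext fun k => ?_))
    · exact congrArg (fun t : groupHomology.inhomogeneousChains A ⟶ _ => (t.f (n + 1)).hom x.1)
        (groupHomology.chainsMap_id_comp f g)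
    · exact congrArg (fun t : groupHomology.inhomogeneousChains (Rep.res (S k).subtype A) ⟶ _ =>
        (t.f n).hom (x.2 k)) (groupHomology.chainsMap_id_comp (resHom S f k) (resHom S g k))

end RelMap

/-! ### The group ring as a free module over the group and its subgroups -/

section GroupRingBasis

variable (K G : Type u) [CommRing K] [Group G]

/-- The standard basis of the group ring. -/
def groupRingBasis : Module.Basis G K (rightRegular K G) := MonoidAlgebra.basis G K

variable {K G}

lemma groupRingBasis_apply (g : G) :
    groupRingBasis K G g = (MonoidAlgebra.single g (1 : K) : MonoidAlgebra K G) := rfl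

lemma rightRegular_ρ_groupRingBasis (h g : G) :
    (rightRegular K G).ρ h (groupRingBasis K G g) = groupRingBasis K G (g * h⁻¹) := by
  rw [groupRingBasis_apply, groupRingBasis_apply]
  change MonoidAlgebra.single g (1 : K) * MonoidAlgebra.single h⁻¹ (1 : K) = _
  rw [MonoidAlgebra.single_mul_single, mul_one]

lemma leftMul_groupRingBasis (h g : G) :
    (leftMul K h).hom (groupRingBasis K G g) = groupRingBasis K G (h * g) := by
  rw [groupRingBasis_apply, groupRingBasis_apply]
  change MonoidAlgebra.single h (1 : K) * MonoidAlgebra.single g (1 : K) = _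
  rw [MonoidAlgebra.single_mul_single, mul_one]

variable (K G) in
/-- The augmentation of the group ring. -/
def augmentation : rightRegular K G ⟶ Rep.trivial K G K :=
  Rep.ofHom ⟨(groupRingBasis K G).constr K fun _ => (1 : K), fun h => by
    refine (groupRingBasis K G).ext fun g => ?_
    have e : ∀ x : G, (groupRingBasis K G).constr K (fun _ => (1 : K))
        (groupRingBasis K G x) = 1 := fun x => Module.Basis.constr_basis _ _ _ _
    refine (congrArg _ (rightRegular_ρ_groupRingBasis h g)).trans ((e _).trans (e g).symm)⟩

lemma augmentation_groupRingBasis (g : G) :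
    (augmentation K G).hom (groupRingBasis K G g) = (1 : K) :=
  Module.Basis.constr_basis _ _ _ _

lemma leftMul_augmentation (g : G) : leftMul K g ≫ augmentation K G = augmentation K G := by
  refine Rep.hom_ext (Representation.IntertwiningMap.ext ((groupRingBasis K G).ext fun x => ?_))
  refine (congrArg (augmentation K G).hom (leftMul_groupRingBasis g x)).trans ?_
  exact (augmentation_groupRingBasis _).trans (augmentation_groupRingBasis _).symm

lemma exists_d_eq_rightRegular {n : ℕ}
    (c : (groupHomology.inhomogeneousChains (rightRegular K G)).X (n + 1))
    (hc : (groupHomology.inhomogeneousChains (rightRegular K G)).d (n + 1) n c = 0) :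
    ∃ c', (groupHomology.inhomogeneousChains (rightRegular K G)).d (n + 2) (n + 1) c' = c := by
  rw [groupHomology.inhomogeneousChains.d_def] at hc ⊢
  exact exists_d_eq_of_basis (rightRegular K G) (groupRingBasis K G) (fun h g => g * h⁻¹)
    rightRegular_ρ_groupRingBasis id (fun _ _ => rfl) c hc

lemma exists_d_eq_res_rightRegular (T : Subgroup G) {n : ℕ}
    (c : (groupHomology.inhomogeneousChains (Rep.res T.subtype (rightRegular K G))).X (n + 1))
    (hc : (groupHomology.inhomogeneousChains (Rep.res T.subtype (rightRegular K G))).d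
      (n + 1) n c = 0) :
    ∃ c', (groupHomology.inhomogeneousChains (Rep.res T.subtype (rightRegular K G))).d
      (n + 2) (n + 1) c' = c := by
  rw [groupHomology.inhomogeneousChains.d_def] at hc ⊢
  -- Choosing a representative of each coset `gT` writes `g` as representative times an element of
  -- `T`. That element is the orbit label `τ g` for right translation by `T`.
  have hT : ∀ g : G, (Quotient.out (g : G ⧸ T))⁻¹ * g ∈ T := fun g => by
    rw [← QuotientGroup.eq]
    exact QuotientGroup.out_eq' _
  refine exists_d_eq_of_basis (Rep.res T.subtype (rightRegular K G)) (groupRingBasis K G)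
    (fun h g => g * (h : G)⁻¹) (fun h g => rightRegular_ρ_groupRingBasis (h : G) g)
    (fun g => ⟨(Quotient.out (g : G ⧸ T))⁻¹ * g, hT g⟩) (fun h g => Subtype.ext ?_) c hc
  have e : ((g * (h : G)⁻¹ : G) : G ⧸ T) = (g : G ⧸ T) :=
    QuotientGroup.eq.2 (by simp)
  simp only [e, Subgroup.coe_mul, Subgroup.coe_inv, mul_assoc]

end GroupRingBasis

/-! ### The complex of relative chains over the group ring -/

section RelRep

variable {K G : Type u} [CommRing K] [Group G] {m : ℕ} (S : Fin m → Subgroup G)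

lemma relChains_d_succ (A : Rep.{u} K G) (n : ℕ) :
    (relChains S A).d (n + 1) n = coneD (inclMap S A) n := cone_d _ n

/-- In degree zero the inclusion `C_0(S k; A) → C_0(G; A)` is the identity of `A`, so a single
subgroup already suffices. This is where nonemptiness of the family enters. -/
lemma relChains_d_one_surjective (hm : 0 < m) (A : Rep.{u} K G) :
    Function.Surjective ((relChains S A).d 1 0) := by
  intro z
  obtain ⟨t, rfl⟩ : ∃ t : (Fin 0 → G) →₀ A, t = z := ⟨z, rfl⟩
  let k : Fin m := ⟨0, hm⟩
  let w : (groupHomology.inhomogeneousChains (Rep.res (S k).subtype A)).X 0 :=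
    (Finsupp.single (fun i => i.elim0) (t fun i => i.elim0) : (Fin 0 → S k) →₀ A)
  have hw : (inclMap S A k).f 0 w = t := by
    refine (groupHomology.chainsMap_f_single _ _ _ _ _).trans ?_
    refine Finsupp.ext fun g => ?_
    obtain rfl : g = fun i => i.elim0 := Subsingleton.elim _ _
    have e : (⇑(S k).subtype ∘ fun i : Fin 0 => (i.elim0 : S k)) = fun i => i.elim0 :=
      Subsingleton.elim _ _
    rw [e]
    exact Finsupp.single_eq_same
  have hs : ∑ l, (inclMap S A l).f 0 ((Pi.single k w : ∀ l, (groupHomology.inhomogeneousChains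
      (Rep.res (S l).subtype A)).X 0) l) = t := by
    rw [Finset.sum_eq_single k]
    · rw [Pi.single_eq_same, hw]
    · intro l _ hl
      rw [Pi.single_eq_of_ne hl, map_zero]
    · simp
  refine ⟨((0, Pi.single k w) : (groupHomology.inhomogeneousChains A).X 1 ×
    ∀ k, (groupHomology.inhomogeneousChains (Rep.res (S k).subtype A)).X 0), ?_⟩
  rw [relChains_d_succ]
  refine (coneD_zero_apply _ _).trans ?_
  refine (congrArg₂ (· + ·) (map_zero _) hs).trans (zero_add _)

/-- The subgroup components of a cycle of degree `n + 2` have degree `n + 1 > 0`, where the bar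
complexes of the subgroups are exact. In total degree one this fails, and the homology there is `M`.
-/
lemma exists_d_eq_relChains_rightRegular {n : ℕ}
    (x : (relChains S (rightRegular K G)).X (n + 2))
    (hx : (relChains S (rightRegular K G)).d (n + 2) (n + 1) x = 0) :
    ∃ y, (relChains S (rightRegular K G)).d (n + 3) (n + 2) y = x := by
  rw [relChains_d_succ] at hx ⊢
  obtain ⟨z, w⟩ : (groupHomology.inhomogeneousChains (rightRegular K G)).X (n + 2) ×
    ∀ k, (groupHomology.inhomogeneousChains (Rep.res (S k).subtype (rightRegular K G))).X
      (n + 1) := x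
  replace hx := (coneD_succ_apply _ _ _).symm.trans hx
  have hz := congrArg Prod.fst hx
  have hw : ∀ k, (groupHomology.inhomogeneousChains
      (Rep.res (S k).subtype (rightRegular K G))).d (n + 1) n (w k) = 0 := fun k =>
    neg_eq_zero.1 (congrFun (congrArg Prod.snd hx) k)
  choose v hv using fun k => exists_d_eq_res_rightRegular (S k) (w k) (hw k)
  -- Once each `w k` bounds `v k`, adding the images of the `v k` to `z` gives an absolute cycle.
  -- The minus sign in the witness `(y, -v)` below matches the sign in the cone differential.
  obtain ⟨y, hy⟩ := exists_d_eq_rightRegular (K := K) (G := G)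
    (z + ∑ k, (inclMap S (rightRegular K G) k).f (n + 2) (v k)) (by
      rw [map_add, map_sum]
      refine Eq.trans (congrArg (_ + ·) (Finset.sum_congr rfl fun k _ => ?_)) hz
      exact (comm_apply _ _ _ _).symm.trans (congrArg _ (hv k)))
  refine ⟨((y, fun k => - v k) : (groupHomology.inhomogeneousChains (rightRegular K G)).X (n + 3) ×
    ∀ k, (groupHomology.inhomogeneousChains (Rep.res (S k).subtype (rightRegular K G))).X
      (n + 2)), ?_⟩
  refine (coneD_succ_apply _ _ _).trans (Prod.ext ?_ (funext fun k => ?_))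
  · dsimp only
    refine (congrArg (· + _) hy).trans ?_
    simp only [map_neg, Finset.sum_neg_distrib, add_neg_cancel_right]
  · dsimp only
    rw [map_neg, neg_neg, hv]

/-- The relative chains with coefficients in the bimodule `K[G]`, as a `G`-representation via
left multiplication on the coefficients. -/
def relRep (n : ℕ) : Rep.{u} K G :=
  Rep.of (X := (relChains S (rightRegular K G)).X n)
    { toFun := fun g => ((relChainsMap S (leftMul K g)).f n).hom
      map_one' := by
        rw [leftMul_one, relChainsMap_id]
        rfl
      map_mul' := fun g h => by
        rw [leftMul_mul, relChainsMap_comp]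
        rfl }

/-- The boundary of relative chains, as a morphism of representations. -/
def relRepD (n : ℕ) : relRep (K := K) S (n + 1) ⟶ relRep S n :=
  Rep.ofHom ⟨((relChains S (rightRegular K G)).d (n + 1) n).hom, fun g =>
    LinearMap.ext fun x => ((comm_apply (relChainsMap S (leftMul K g)) (n + 1) n x)).symm⟩

/-- The basis of `relRep`. -/
abbrev relRepBasis (n : ℕ) : Module.Basis (RelIndex S G n) K (relRep (K := K) S n) :=
  relBasis S (groupRingBasis K G) n

lemma relRep_ρ_basis (n : ℕ) (g : G) (x : RelIndex S G n) :
    (relRep (K := K) S n).ρ g (relRepBasis S n x) =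
      relRepBasis S n (RelIndex.map S (g * ·) x) :=
  relChainsMap_relBasis S (leftMul K g) _ _ (g * ·) (leftMul_groupRingBasis g) x

lemma isZero_groupHomology_relRep (n i : ℕ) :
    Limits.IsZero (groupHomology (relRep (K := K) S n) (i + 1)) := by
  refine isZero_homology_of_exact (groupHomology.inhomogeneousChains (relRep (K := K) S n))
    (i := i + 2) (j := i + 1) (k := i) (by simp) (by simp) fun c hc => ?_
  rw [groupHomology.inhomogeneousChains.d_def] at hc ⊢
  refine exists_d_eq_of_basis (relRep (K := K) S n) (relRepBasis S n) _ (relRep_ρ_basis S n)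
    -- The group acts on the label in `G` by left multiplication, so the inverse label transforms by
    -- right multiplication by `h⁻¹`.
    (fun x => (RelIndex.coeff S x)⁻¹) (fun h x => ?_) c hc
  rw [RelIndex.coeff_map, mul_inv_rev]

/-- The map from relative chains with coefficients in `K[G]` to those with trivial coefficients. -/
abbrev relAug (n : ℕ) :
    relRep (K := K) S n →ₗ[K] (relChains S (Rep.trivial K G K)).X n :=
  ((relChainsMap S (augmentation K G)).f n).hom

/-- The basis of relative chains with trivial coefficients. -/
abbrev relTrivialBasis (n : ℕ) : Module.Basis (RelIndex S PUnit.{u + 1} n) K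
    ((relChains S (Rep.trivial K G K)).X n) :=
  relBasis S (A := Rep.trivial K G K) (Module.Basis.singleton PUnit.{u + 1} K) n

lemma relAug_basis (n : ℕ) (x : RelIndex S G n) :
    relAug (K := K) S n (relRepBasis S n x) =
      relTrivialBasis S n (RelIndex.map S (fun _ => PUnit.unit) x) :=
  relChainsMap_relBasis S (augmentation K G) _ _ (fun _ => PUnit.unit)
    (fun g => (augmentation_groupRingBasis g).trans
      (Module.Basis.singleton_apply PUnit.{u + 1} K _).symm) x

/-- The section of `relAug` given by the neutral element of the group. -/
def relAugSection (n : ℕ) :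
    (relChains S (Rep.trivial K G K)).X n →ₗ[K] relRep (K := K) S n :=
  (relTrivialBasis S n).constr K fun x => relRepBasis S n (RelIndex.map S (fun _ => (1 : G)) x)

lemma relAugSection_basis (n : ℕ) (x : RelIndex S PUnit.{u + 1} n) :
    relAugSection (K := K) S n (relTrivialBasis S n x) =
      relRepBasis S n (RelIndex.map S (fun _ => (1 : G)) x) :=
  Module.Basis.constr_basis _ _ _ _

lemma relAug_surjective (n : ℕ) : Function.Surjective (relAug (K := K) S n) := by
  have e : relAug (K := K) S n ∘ₗ relAugSection S n = LinearMap.id := by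
    refine (relTrivialBasis S n).ext fun x => ?_
    rw [LinearMap.comp_apply, relAugSection_basis, relAug_basis, RelIndex.map_map]
    exact congrArg _ (RelIndex.map_id S x)
  exact fun y => ⟨relAugSection S n y, LinearMap.congr_fun e y⟩

/-- This identifies the coinvariants of the free representation with the relative chains with
trivial coefficients. Every basis element is a translate of the one with label `1`, so augmenting
and then applying the section changes nothing modulo the action. Conversely, the augmentation is
invariant under left multiplication. -/
lemma relAug_eq_zero_iff (n : ℕ) (x : relRep (K := K) S n) :
    relAug S n x = 0 ↔ x ∈ Representation.Coinvariants.ker (relRep (K := K) S n).ρ := by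
  constructor
  · intro h
    have e : Representation.Coinvariants.mk (relRep (K := K) S n).ρ ∘ₗ relAugSection S n ∘ₗ
        relAug S n = Representation.Coinvariants.mk (relRep (K := K) S n).ρ := by
      refine (relRepBasis S n).ext fun y => ?_
      rw [LinearMap.comp_apply, LinearMap.comp_apply, relAug_basis, relAugSection_basis,
        RelIndex.map_map]
      -- Resetting the label to `1` is translation by the inverse of the label.
      have e1 : RelIndex.map S ((fun _ => (1 : G)) ∘ fun _ => PUnit.unit.{u + 1}) y =
          RelIndex.map S ((RelIndex.coeff S y)⁻¹ * ·) y :=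
        RelIndex.map_congr S (inv_mul_cancel _).symm
      rw [e1, ← relRep_ρ_basis]
      exact Representation.Coinvariants.mk_self_apply _ _ _
    rw [← Representation.Coinvariants.mk_eq_zero, ← e, LinearMap.comp_apply, LinearMap.comp_apply,
      h, map_zero, map_zero]
  · intro h
    have hle : Representation.Coinvariants.ker (relRep (K := K) S n).ρ ≤
        LinearMap.ker (relAug (K := K) S n) := by
      refine Submodule.span_le.2 ?_
      rintro _ ⟨⟨g, y⟩, rfl⟩
      have e := relChainsMap_comp S (leftMul K g) (augmentation K G)
      rw [leftMul_augmentation] at e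
      refine (map_sub _ _ _).trans (sub_eq_zero.2 ?_)
      exact (congrArg (fun t : relChains S (rightRegular K G) ⟶ _ => (t.f n).hom y) e).symm
    exact hle h

lemma relAug_relRepD (n : ℕ) (x : relRep (K := K) S (n + 1)) :
    relAug S n ((relRepD S n).hom x) =
      (relChains S (Rep.trivial K G K)).d (n + 1) n (relAug S (n + 1) x) :=
  comm_apply (relChainsMap S (augmentation K G)) (n + 1) n x

end RelRep

/-! ### Naturality of the cap product in the coefficients -/

section Naturality

variable {K : Type u} [CommRing K]

lemma mapHomology_naturality {C C' : CochainComplex (ModuleCat.{u} K) ℕ}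
    {D D' : ChainComplex (ModuleCat.{u} K) ℕ} {i j : ℕ} (α : C ⟶ C') (β : D ⟶ D')
    (t : C.X i ⟶ D.X j) (t' : C'.X i ⟶ D'.X j)
    (h₁ : ∀ j', j' + 1 = j → ∃ s : C.X (i + 1) ⟶ D.X j', t ≫ D.d j j' = C.d i (i + 1) ≫ s)
    (h₂ : ∀ i', i' + 1 = i → ∃ s : C.X i' ⟶ D.X (j + 1), C.d i' i ≫ t = s ≫ D.d (j + 1) j)
    (h₁' : ∀ j', j' + 1 = j → ∃ s : C'.X (i + 1) ⟶ D'.X j', t' ≫ D'.d j j' = C'.d i (i + 1) ≫ s)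
    (h₂' : ∀ i', i' + 1 = i → ∃ s : C'.X i' ⟶ D'.X (j + 1), C'.d i' i ≫ t' = s ≫ D'.d (j + 1) j)
    (h : t ≫ β.f j = α.f i ≫ t') :
    mapHomology C D t h₁ h₂ ≫ HomologicalComplex.homologyMap β j =
      HomologicalComplex.homologyMap α i ≫ mapHomology C' D' t' h₁' h₂' := by
  have e : C.homologyπ i ≫ mapHomology C D t h₁ h₂ =
      D.liftCycles (C.iCycles i ≫ t) _ rfl (mapHomology_aux₁ C D t h₁) ≫ D.homologyπ j :=
    (C.sc i).π_descHomology _ _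
  have e' : C'.homologyπ i ≫ mapHomology C' D' t' h₁' h₂' =
      D'.liftCycles (C'.iCycles i ≫ t') _ rfl (mapHomology_aux₁ C' D' t' h₁') ≫ D'.homologyπ j :=
    (C'.sc i).π_descHomology _ _
  rw [← cancel_epi (C.homologyπ i), reassoc_of% e, HomologicalComplex.homologyπ_naturality_assoc,
    e', HomologicalComplex.homologyπ_naturality, ← Category.assoc, ← Category.assoc]
  congr 1
  rw [← cancel_mono (D'.iCycles j)]
  simp [h]

variable {H : Type u} [Group H]

/-- The cap product is natural in the coefficients. -/
lemma chainsMap_cap {A B : Rep.{u} K H} (f : A ⟶ B) {n i j : ℕ} (h : i + j = n)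
    (z : (Fin n → H) →₀ K) (c : (Fin i → H) → A) :
    (groupHomology.chainsMap (MonoidHom.id H) f).f j (cap A h z c) =
      cap B h z ((groupCohomology.cochainsMap (MonoidHom.id H) f).f i c) := by
  induction z using Finsupp.induction_linear with
  | zero => simp
  | add z w hz hw => simp only [map_add, LinearMap.add_apply, hz, hw]
  | single g r =>
    rw [cap_single, cap_single, map_smul]
    refine congrArg (r • ·) ((groupHomology.chainsMap_f_single _ _ _ _ _).trans ?_)
    exact congrArg (Finsupp.single (back h g)) (Rep.hom_comm_apply f _ _)

variable {m : ℕ} (S : Fin m → Subgroup H)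

lemma capAbs_naturality {A B : Rep.{u} K H} (f : A ⟶ B) {n i j : ℕ} (h : i + j = n)
    (e : (relChains S (Rep.trivial K H K)).X n) :
    capAbs S A h e ≫ (relChainsMap S f).f j =
      (groupCohomology.cochainsMap (MonoidHom.id H) f).f i ≫ capAbs S B h e := by
  refine ModuleCat.hom_ext (LinearMap.ext fun c => ?_)
  match n, j, h, e with
  | n, 0, h, e => exact chainsMap_cap f h (chainPart S e) c
  | 0, j + 1, h, _ => omega
  | n + 1, j + 1, h, e =>
    refine Prod.ext (chainsMap_cap f h (chainPart S e) c) (funext fun k => ?_)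
    refine (map_smul ((groupHomology.chainsMap (A := Rep.res (S k).subtype A)
      (B := Rep.res (S k).subtype B) (MonoidHom.id (S k)) (resHom S f k)).f j).hom
      ((-1 : K) ^ i) _).trans (congrArg ((-1 : K) ^ i • ·) ?_)
    exact chainsMap_cap (resHom S f k) (Nat.succ.inj h) (bdryPart S e k) ((resMap S A k).f i c)

/-- Applied to left multiplications on `K[G]`, this makes the duality isomorphism `H^{n-1}(G; K[G])
≅ H_1(G, 𝒮; K[G])` equivariant. -/
lemma capAbsHomology_naturality {A B : Rep.{u} K H} (f : A ⟶ B) {n i j : ℕ} (h : i + j = n)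
    (e : (relChains S (Rep.trivial K H K)).X n)
    (he : ∀ p, (relChains S (Rep.trivial K H K)).d n p e = 0) :
    capAbsHomology S A h e he ≫ HomologicalComplex.homologyMap (relChainsMap S f) j =
      groupCohomology.map (MonoidHom.id H) f i ≫ capAbsHomology S B h e he :=
  mapHomology_naturality _ _ _ _ _ _ _ _ (capAbs_naturality S f h e)

end Naturality

/-! ### Comparison of `H_1(G; M)` with the relative homology in degree two -/

section Main

variable {K G : Type u} [CommRing K] [Group G] {m : ℕ} (S : Fin m → Subgroup G)

lemma exists_linearEquiv_of_surjective {R P X Y : Type*} [CommRing R] [AddCommGroup P]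
    [AddCommGroup X] [AddCommGroup Y] [Module R P] [Module R X] [Module R Y] {φ : P →ₗ[R] X}
    {ψ : P →ₗ[R] Y} (hφ : Function.Surjective φ) (hψ : Function.Surjective ψ)
    (h : ∀ p, φ p = 0 ↔ ψ p = 0) : Nonempty (X ≃ₗ[R] Y) := by
  have hker : LinearMap.ker φ = LinearMap.ker ψ := by
    ext p
    exact h p
  exact ⟨(φ.quotKerEquivOfSurjective hφ).symm ≪≫ₗ Submodule.quotEquivOfEq _ _ hker ≪≫ₗ
    ψ.quotKerEquivOfSurjective hψ⟩

/-- The cycles of the relative chains with trivial coefficients, lifted to coefficients `K[G]`. -/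
def relCyclesLift : Submodule K (relRep (K := K) S 2) :=
  (LinearMap.ker ((relChains S (Rep.trivial K G K)).d 2 1).hom).comap (relAug S 2)

/-- If the homology in degree one of the relative chains with coefficients in `K[G]` is the
representation `M`, then `H₁(G; M)` is the relative homology in degree two. -/
theorem groupHomology_one_equiv_relHomology (hm : 0 < m) {M : Rep.{u} K G}
    (π : subRep (kerSubrep (relRepD (K := K) S 0)) ⟶ M) (hπ : Function.Surjective π.hom)
    (hπd : ∀ z, π.hom z = 0 ↔ ∃ p, (relRepD S 1).hom p = z.1) :
    Nonempty (groupHomology M 1 ≃ₗ[K] relHomology S (Rep.trivial K G K) 2) := by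
  have hdd : ∀ p, (relRepD S 0).hom ((relRepD (K := K) S 1).hom p) = 0 := fun p =>
    d_d_apply (relChains S (rightRegular K G)) 2 1 0 p
  obtain ⟨Φ, hΦ, hΦ'⟩ := exists_surjective_groupHomology_one (relRepD (K := K) S 0)
    (relChains_d_one_surjective S hm _) (liftKer _ (relRepD S 1) hdd) π hπ
    (fun z => (hπd z).trans (exists_congr fun p =>
      (Subtype.ext_iff (a1 := (liftKer _ (relRepD S 1) hdd).hom p) (a2 := z)).symm))
    (isZero_groupHomology_relRep S 1 0) (isZero_groupHomology_relRep S 0 0)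
    (isZero_groupHomology_relRep S 0 1) (relCyclesLift S)
    (fun p => by
      -- The boundary of `p` dies in the coinvariants of `F_1` exactly when the augmentation of `p`
      -- is a cycle, because the augmentation commutes with boundaries.
      rw [← relAug_eq_zero_iff]
      refine Eq.congr_left ?_
      exact (relAug_relRepD S 1 p).symm)
  have hnext : (ComplexShape.down ℕ).next 2 = 1 := by simp
  have hprev : (ComplexShape.down ℕ).prev 2 = 3 := by simp
  let r : relCyclesLift S →ₗ[K] LinearMap.ker ((relChains S (Rep.trivial K G K)).d 2 1).hom :=
    (relAug (K := K) S 2).restrict fun _ hp => hp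
  have hr : Function.Surjective r := fun y => by
    obtain ⟨p, hp⟩ := relAug_surjective (K := K) S 2 y.1
    exact ⟨⟨p, show relAug S 2 p ∈ _ from hp ▸ y.2⟩, Subtype.ext hp⟩
  refine exists_linearEquiv_of_surjective hΦ
    (ψ := homologyClass (relChains S (Rep.trivial K G K)) hnext ∘ₗ r)
    ((homologyClass_surjective _ hnext).comp hr) fun p => (hΦ' p).trans
      (Iff.trans ?_ (homologyClass_eq_zero_iff _ hprev hnext (r p)).symm)
  constructor
  -- The chains `p` and `c` have the same boundary, so exactness in degree 2 gives `p - c = ∂ q`.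
  -- The augmentation kills `c`, hence the augmentation of `p` bounds.
  · rintro ⟨c, hc, hpc⟩
    have hpc' : (relRepD S 1).hom p.1 = (relRepD S 1).hom c := congrArg Subtype.val hpc
    obtain ⟨q, hq⟩ := exists_d_eq_relChains_rightRegular S (p.1 - c)
      ((map_sub (relRepD S 1).hom p.1 c).trans (sub_eq_zero.2 hpc'))
    refine ⟨relAug S 3 q, (relAug_relRepD S 2 q).symm.trans ?_⟩
    refine (congrArg (relAug S 2) hq).trans ((map_sub _ _ _).trans ?_)
    rw [(relAug_eq_zero_iff S 2 c).2 hc, sub_zero]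
    rfl
  · rintro ⟨y, hy⟩
    -- After lifting the bounding chain to `q` over `K[G]`, the chain `p - ∂ q` has zero
    -- augmentation and the same boundary as `p`.
    obtain ⟨q, rfl⟩ := relAug_surjective S 3 y
    have e := (relAug_relRepD S 2 q).trans hy
    refine ⟨p.1 - (relRepD S 2).hom q, (relAug_eq_zero_iff S 2 _).1 ?_, Subtype.ext ?_⟩
    · rw [map_sub, e]
      exact sub_self _
    · refine Eq.trans ?_ (map_sub (relRepD S 1).hom p.1 ((relRepD S 2).hom q)).symm
      have e2 : (relRepD S 1).hom ((relRepD (K := K) S 2).hom q) = 0 :=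
        d_d_apply (relChains S (rightRegular K G)) 3 2 1 q
      rw [e2, sub_zero]
      rfl

/-- Duality with coefficients `K[G]` provides the cover `π`: a 1-cycle of `F` goes to its homology
class, carried back to `H^{n-1}(G; K[G])` by the inverse of the cap product. Its kernel consists of
the boundaries. -/
lemma groupHomology_groupRingCohomology_equiv (hm : 0 < m) {n i : ℕ} (h : i + 1 = n)
    (e : (relChains S (Rep.trivial K G K)).X n)
    (he : ∀ p, (relChains S (Rep.trivial K G K)).d n p e = 0)
    (hiso : IsIso (capAbsHomology S (rightRegular K G) h e he)) :
    Nonempty (groupHomology (groupRingCohomology K G i) 1 ≃ₗ[K]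
      relHomology S (Rep.trivial K G K) 2) := by
  let κ : groupRingCohomology K G i ≃ₗ[K] (relChains S (rightRegular K G)).homology 1 :=
    (asIso (capAbsHomology S (rightRegular K G) h e he)).toLinearEquiv
  have hκ : ∀ (g : G) (x : groupRingCohomology K G i),
      κ ((groupRingCohomology K G i).ρ g x) =
        HomologicalComplex.homologyMap (relChainsMap S (leftMul K g)) 1 (κ x) := fun g x =>
    (congrArg (fun t => t.hom x) (capAbsHomology_naturality S (leftMul K g) h e he)).symm
  have hnext : (ComplexShape.down ℕ).next 1 = 0 := by simp
  have hprev : (ComplexShape.down ℕ).prev 1 = 2 := by simp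
  let cls : subRep (kerSubrep (relRepD (K := K) S 0)) →ₗ[K]
    (relChains S (rightRegular K G)).homology 1 :=
    homologyClass (relChains S (rightRegular K G)) hnext
  let π : subRep (kerSubrep (relRepD (K := K) S 0)) ⟶ groupRingCohomology K G i :=
    Rep.ofHom ⟨κ.symm.toLinearMap ∘ₗ cls, fun g => LinearMap.ext fun z => by
      -- Equivariance is checked after applying `κ`, where it says that left multiplication on
      -- chains induces its action on homology classes.
      refine κ.injective ?_
      refine (κ.apply_symm_apply _).trans (Eq.trans ?_ (hκ g _).symm)
      refine Eq.trans ?_ (congrArg _ (κ.apply_symm_apply (cls z)).symm)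
      exact (homologyMap_homologyClass (relChainsMap S (leftMul K g)) hnext z _ rfl).symm⟩
  refine groupHomology_one_equiv_relHomology S hm π
    (κ.symm.surjective.comp (homologyClass_surjective _ hnext)) fun z => ?_
  refine (κ.symm.map_eq_zero_iff).trans ?_
  exact homologyClass_eq_zero_iff (relChains S (rightRegular K G)) hprev hnext z

end Main

lemma isZero_relHomology_zero {K G : Type u} [CommRing K] [Group G] {m : ℕ} (hm : 0 < m)
    (S : Fin m → Subgroup G) (A : Rep.{u} K G) : Limits.IsZero (relHomology S A 0) :=
  isZero_homology_of_exact (relChains S A) (i := 1) (j := 0) (k := 0) (by simp) (by simp)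
    fun x _ => relChains_d_one_surjective S hm A x

lemma isZero_groupHomology_zero_of_subsingleton {K G : Type u} [CommRing K] [Group G]
    (A : Rep.{u} K G) [Subsingleton A] : Limits.IsZero (groupHomology A 0) :=
  ModuleCat.isZero_iff_subsingleton.2 (H0π_surjective A).subsingleton

end FoxPairing

end

theorem theorem8p3 {K G : Type u} [CommRing K] [Group G] {m : ℕ} (hm : 0 < m)
    (S : Fin m → Subgroup G) (n : ℕ) (hPD : FoxPairing.IsPDPair K S n) :
    Nonempty (FoxPairing.relCohomology S (FoxPairing.groupRingCohomology K G (n - 1)) (n - 1) ≃ₗ[K]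
      FoxPairing.relHomology S (Rep.trivial K G K) 2) := by
  obtain ⟨e, he, hPD⟩ := hPD
  cases n with
  | zero =>
    -- For `n = 0` the truncated degree `n - 1` is `0`, and both sides vanish. Duality gives `M ≅
    -- H_0(G, 𝒮; K[G]) = 0`, hence `H^0(G, 𝒮; M) ≅ H_0(G; M) = 0`, while `H_2(G, 𝒮; K) = 0` because
    -- `2` exceeds the dimension.
    have h₁ := ((hPD (FoxPairing.rightRegular K G)).1 0 0 rfl).2
    have hM : Subsingleton (FoxPairing.groupRingCohomology K G 0) :=
      ModuleCat.isZero_iff_subsingleton.1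
        ((FoxPairing.isZero_relHomology_zero hm S _).of_iso (asIso (FoxPairing.capAbsHomology S
          (FoxPairing.rightRegular K G) rfl e he)))
    have h₂ := ((hPD (FoxPairing.groupRingCohomology K G 0)).1 0 0 rfl).1
    have h₃ := (FoxPairing.isZero_groupHomology_zero_of_subsingleton
      (FoxPairing.groupRingCohomology K G 0)).of_iso (asIso (FoxPairing.capRelHomology S
        (FoxPairing.groupRingCohomology K G 0) rfl e he))
    have h₄ := ((hPD (Rep.trivial K G K)).2 2 two_pos).2.2.1
    exact ⟨(h₃.iso h₄).toLinearEquiv⟩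
  | succ n =>
    -- The two uses of duality: `h₁` is the absolute cap product that identifies the coefficients,
    -- and `h₂` is the relative one that turns cohomology in degree `n` into `H_1(G; M)`.
    have h₁ := ((hPD (FoxPairing.rightRegular K G)).1 n 1 rfl).2
    have h₂ := ((hPD (FoxPairing.groupRingCohomology K G n)).1 n 1 rfl).1
    obtain ⟨E⟩ := FoxPairing.groupHomology_groupRingCohomology_equiv S hm rfl e he h₁
    exact ⟨(asIso (FoxPairing.capRelHomology S (FoxPairing.groupRingCohomology K G n) rfl e
      he)).toLinearEquiv ≪≫ₗ E⟩
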